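/- All graphs are finite, undirected and simple. A graph is $3$-connected if it has at least four vertices and remains connected after the deletion of any set of at most two vertices. Let $m\ge 1$ be an integer, let $T_0$ be any tree with $m$ vertices, and let $G$ be a $3$-connected graph in which every vertex has degree at least $m+3$. Then $G$ contains a (not necessarily induced) subgraph $T$ isomorphic to $T_0$ such that the graph $G-V(T)$, obtained from $G$ by deleting all vertices of $T$, is $3$-connected. -/

import Mathlib

/-- A finite simple graph is `k`-connected if it has more than `k` vertices and it stays connected
after the deletion of any set of fewer than `k` vertices. -/
def SimpleGraph.IsKConnected {V : Type*} [Finite V] (G : SimpleGraph V) (k : ℕ) : Prop :=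
  k < Nat.card V ∧ ∀ S : Finset V, S.card < k → (G.induce ((S : Set V)ᶜ)).Connected

/-!
Root the tree `T₀`, and call a set `K` *inseparable* in `X ⊇ K` if no two of its vertices are
separated by at most two vertices in `G[X]`. A greedily placed copy of `T₀` leaves a graph of
minimum degree at least three, and such a graph has an inseparable set of at least four vertices,
namely a smallest set with at most two outside neighbours within a smallest set with at most one,
together with these neighbours. So there are a copy of `T₀` and a set `K` of at least four vertices
that is inseparable in its complement; choose them with `K` as large as possible. The goal is to let
the copy of `T₀` use up everything outside `K`, because then `G[K]` is `3`-connected.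

Two tools are used. *Exchange*: if `Z` contains a copy of `T₀` and a further vertex, and every
vertex of `Z` outside a nonempty set `A` has at least `m` neighbours in `Z`, then some vertex of `A`
can be deleted from `Z` so that a copy of `T₀` survives; this is where the degree condition enters.
*Tripod*: a connected set attached to three vertices of `K` contains a vertex that can be added to
`K`, which the maximality of `K` forbids.

Among the possible `X`, pick one with the largest connected set `D` outside `K`, and then the
smallest such `X`; exchanging vertices gives `X = K ∪ D`. By the tripod argument `D` matters only as
a link between two vertices of `K`, so it may be replaced by any such link; let `Q` be a smallest
one that leaves room for a copy of `T₀`. If there were more than `m` vertices outside `K ∪ Q`, then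
a smallest connected set outside `K ∪ Q` that is attached to three vertices of `K`, directly or
through `Q`, would yield a larger inseparable set or a smaller link. So exactly `m` vertices remain,
and the degree condition then makes `Q` empty.
-/

section

open scoped Classical

variable {W V : Type*} {G : SimpleGraph V}

variable (G) in
/-- The number of neighbours of `v` in `X`, where `v` itself need not lie in `X`. -/
noncomputable def degIn (X : Finset V) (v : V) : ℕ := (X.filter (G.Adj v)).card

lemma degIn_univ [Fintype V] [DecidableRel G.Adj] (v : V) :
    degIn G Finset.univ v = G.degree v := by
  rw [degIn, ← G.card_neighborFinset_eq_degree, G.neighborFinset_eq_filter]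
  congr!

lemma degIn_mono {X Y : Finset V} (h : X ⊆ Y) (v : V) : degIn G X v ≤ degIn G Y v :=
  Finset.card_le_card (Finset.filter_subset_filter _ h)

lemma degIn_le_add_card_sdiff (X Y : Finset V) (v : V) :
    degIn G X v ≤ degIn G Y v + (X \ Y).card := by
  refine (Finset.card_le_card fun x hx => ?_).trans (Finset.card_union_le _ _)
  have := Finset.mem_filter.mp hx
  by_cases hxY : x ∈ Y <;> simp [hxY, this]

lemma degIn_le_card (X : Finset V) (v : V) : degIn G X v ≤ X.card := Finset.card_filter_le _ _

lemma degIn_union_le (X Y : Finset V) (v : V) : degIn G (X ∪ Y) v ≤ degIn G X v + degIn G Y v := by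
  rw [degIn, Finset.filter_union]
  exact Finset.card_union_le _ _

lemma degIn_add_degIn_compl [Fintype V] (X : Finset V) (v : V) :
    degIn G X v + degIn G Xᶜ v = degIn G Finset.univ v := by
  rw [degIn, degIn, degIn, ← Finset.card_union_of_disjoint
    (Finset.disjoint_filter_filter disjoint_compl_right), ← Finset.filter_union, Finset.union_compl]

lemma injective_update_of_forall_ne {φ : W → V} (hφ : Function.Injective φ) (t : W) {z : V}
    (hz : ∀ w, φ w ≠ z) : Function.Injective (Function.update φ t z) := by
  intro a b hab
  grind [Function.update_apply, hφ.eq_iff]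

lemma injOn_update_insert {ψ : W → V} {U : Finset W} {w : W} {x : V} (hψ : Set.InjOn ψ U)
    (hx : ∀ v ∈ U, ψ v ≠ x) : Set.InjOn (Function.update ψ w x) (insert w U : Finset W) := by
  intro a ha b hb hab
  have := @hψ a
  grind [Function.update_apply]

/-! ### Copies of a rooted tree -/

/-- A finite tree with a chosen root, recorded by its parent map. -/
structure ParentTree (W : Type*) where
  root : W
  parent : W → W
  depth : W → ℕ
  depth_parent_lt : ∀ w, w ≠ root → depth (parent w) < depth w

namespace ParentTree

variable {T : ParentTree W} {Z : Finset V} {φ : W → V}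

variable (T G) in
/-- `φ` embeds the rooted tree `T` into the subgraph of `G` induced on `Z`. -/
structure IsEmb (Z : Finset V) (φ : W → V) : Prop where
  inj : Function.Injective φ
  adj : ∀ w, w ≠ T.root → G.Adj (φ w) (φ (T.parent w))
  mem : ∀ w, φ w ∈ Z

variable (T G) in
/-- The subgraph of `G` induced on `Z` contains a copy of `T`. -/
def HasCopy (Z : Finset V) : Prop := ∃ φ, T.IsEmb G Z φ

lemma IsEmb.mono {Z' : Finset V} (hφ : T.IsEmb G Z φ) (h : Z ⊆ Z') : T.IsEmb G Z' φ :=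
  ⟨hφ.inj, hφ.adj, fun w => h (hφ.mem w)⟩

lemma HasCopy.mono {Z' : Finset V} (hZ : T.HasCopy G Z) (h : Z ⊆ Z') : T.HasCopy G Z' :=
  hZ.imp fun _ hφ => hφ.mono h

lemma IsEmb.erase {z : V} (hφ : T.IsEmb G Z φ) (hz : ∀ w, φ w ≠ z) : T.IsEmb G (Z.erase z) φ :=
  ⟨hφ.inj, hφ.adj, fun w => Finset.mem_erase.mpr ⟨hz w, hφ.mem w⟩⟩

lemma IsEmb.ne_of_erase {z : V} (hφ : T.IsEmb G (Z.erase z) φ) (w : W) : φ w ≠ z :=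
  Finset.ne_of_mem_erase (hφ.mem w)

variable (T) in
/-- `T.Desc y w` says that `w` is a descendant of `y` (possibly `y` itself). -/
def Desc (y w : W) : Prop := Relation.ReflTransGen (fun a b => b ≠ T.root ∧ T.parent b = a) y w

lemma Desc.refl (y : W) : T.Desc y y := Relation.ReflTransGen.refl

lemma Desc.trans {a b c : W} (h : T.Desc a b) (h' : T.Desc b c) : T.Desc a c :=
  Relation.ReflTransGen.trans h h'

lemma desc_parent {t : W} (h : t ≠ T.root) : T.Desc (T.parent t) t :=
  Relation.ReflTransGen.single ⟨h, rfl⟩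

lemma Desc.ne_root {y w : W} (h : T.Desc y w) (hne : w ≠ y) : w ≠ T.root := by
  rcases Relation.ReflTransGen.cases_tail h with h | ⟨c, -, hw, -⟩
  exacts [absurd h hne, hw]

lemma Desc.parent {y w : W} (h : T.Desc y w) (hne : w ≠ y) : T.Desc y (T.parent w) := by
  rcases Relation.ReflTransGen.cases_tail h with h | ⟨c, hc, -, rfl⟩
  exacts [absurd h hne, hc]

lemma Desc.exists_child {y w : W} (h : T.Desc y w) (hne : w ≠ y) :
    ∃ c, c ≠ T.root ∧ T.parent c = y ∧ T.Desc c w := by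
  rcases Relation.ReflTransGen.cases_head h with h | ⟨c, ⟨hc, hcy⟩, hcw⟩
  exacts [absurd h.symm hne, ⟨c, hc, hcy, hcw⟩]

lemma Desc.depth_le {y w : W} (h : T.Desc y w) : T.depth y ≤ T.depth w := by
  induction h with
  | refl => exact le_rfl
  | tail _ h ih => exact ih.trans (h.2 ▸ T.depth_parent_lt _ h.1).le

lemma Desc.depth_lt {y w : W} (h : T.Desc y w) (hne : w ≠ y) : T.depth y < T.depth w :=
  (h.parent hne).depth_le.trans_lt (T.depth_parent_lt _ (h.ne_root hne))

lemma not_desc_parent {t : W} (ht : t ≠ T.root) : ¬ T.Desc t (T.parent t) := fun h =>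
  (T.depth_parent_lt t ht).not_ge h.depth_le

lemma desc_root (w : W) : T.Desc T.root w := by
  induction h : T.depth w using Nat.strong_induction_on generalizing w with
  | _ n ih =>
    by_cases hw : w = T.root
    · rw [hw]; exact Desc.refl _
    · exact (ih _ (h ▸ T.depth_parent_lt w hw) _ rfl).trans (desc_parent hw)

lemma Desc.total {a b l : W} (ha : T.Desc a l) (hb : T.Desc b l) : T.Desc a b ∨ T.Desc b a := by
  induction ha with
  | refl => exact Or.inr hb
  | @tail c d hc h ih =>
    by_cases hbd : d = b
    · exact Or.inl (hbd ▸ Relation.ReflTransGen.tail hc h)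
    · exact ih (h.2 ▸ hb.parent hbd)

variable (T) in
/-- `l` is a leaf: it has no child. -/
def IsLeaf (l : W) : Prop := ∀ w, w ≠ T.root → T.parent w ≠ l

lemma exists_isLeaf_desc [Finite W] (c : W) : ∃ l, T.Desc c l ∧ T.IsLeaf l := by
  obtain ⟨l, hl, hmax⟩ := Set.exists_max_image {w | T.Desc c w} T.depth (Set.toFinite _)
    ⟨c, Desc.refl c⟩
  refine ⟨l, hl, fun w hw h => ?_⟩
  have hw_le := hmax w (Desc.trans hl (h ▸ desc_parent hw))
  exact (h ▸ T.depth_parent_lt w hw).not_ge hw_le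

lemma exists_adj_notMem_image {U : Finset W} {ψ : W → V} {D : Finset V} {u : W} (hu : u ∈ U)
    (huD : ψ u ∈ D) (hlt : (U.filter (ψ · ∈ D)).card ≤ degIn G D (ψ u)) :
    ∃ x ∈ D, G.Adj (ψ u) x ∧ ∀ v ∈ U, ψ v ≠ x := by
  by_contra! h
  have hsub : D.filter (G.Adj (ψ u)) ⊆ ((U.filter (ψ · ∈ D)).erase u).image ψ := by
    intro x hx
    obtain ⟨hxD, hux⟩ := Finset.mem_filter.mp hx
    obtain ⟨v, hv, rfl⟩ := h x hxD hux
    have hvu : v ≠ u := by rintro rfl; exact G.irrefl hux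
    exact Finset.mem_image_of_mem _ (by simp [hvu, hv, hxD])
  have hlt' := (Finset.card_le_card hsub).trans Finset.card_image_le
  exact absurd (hlt'.trans_lt (Finset.card_erase_lt_of_mem (by simp [hu, huD]))) hlt.not_gt

/-- The vertices of `S` are placed in `D` one after the other, by increasing depth. -/
lemma exists_greedy_extension {D : Finset V} {K : Finset W} (hφ : Set.InjOn φ K) (S : Finset W)
    (hKS : Disjoint K S) (hroot : T.root ∉ S) (hpar : ∀ w ∈ S, T.parent w ∈ K ∪ S)
    (hparD : ∀ w ∈ S, T.parent w ∈ K → φ (T.parent w) ∈ D)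
    (hdeg : ∀ w ∈ S, ∀ g ∈ D, (T.parent w ∈ K → φ (T.parent w) = g) →
      (K.filter (φ · ∈ D)).card + S.card ≤ degIn G D g + 1) :
    ∃ ψ : W → V, Set.EqOn ψ φ K ∧ Set.InjOn ψ (K ∪ S : Finset W) ∧
      ∀ w ∈ S, ψ w ∈ D ∧ G.Adj (ψ w) (ψ (T.parent w)) := by
  induction S using Finset.induction_on_max_value T.depth with
  | empty => exact ⟨φ, Set.eqOn_refl _ _, by simpa using hφ, by simp⟩
  | insert w S hwS hmax ih =>
    rw [Finset.disjoint_insert_right] at hKS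
    simp only [Finset.mem_insert, not_or] at hroot
    simp only [Finset.mem_insert, forall_eq_or_imp] at hpar hparD hdeg
    rw [Finset.card_insert_of_notMem hwS] at hdeg
    have hne : ∀ v ∈ insert w S, T.parent v ≠ w := by
      intro v hv h
      rcases Finset.mem_insert.mp hv with rfl | hv
      · exact (h ▸ T.depth_parent_lt v (Ne.symm hroot.1)).false
      · exact (h ▸ T.depth_parent_lt v (by grind)).not_ge (hmax v hv)
    obtain ⟨ψ, hψK, hψinj, hψS⟩ := ih hKS.2 hroot.2 (fun v hv => by grind) hparD.2
      fun v hv g hg hgv => by have := hdeg.2 v hv g hg hgv; lia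
    have hparU : T.parent w ∈ K ∪ S := by grind
    have hparw : ψ (T.parent w) ∈ D := by
      rcases Finset.mem_union.mp hparU with h | h
      · exact hψK h ▸ hparD.1 h
      · exact (hψS _ h).1
    have hused : ((K ∪ S).filter (ψ · ∈ D)).card ≤ (K.filter (φ · ∈ D)).card + S.card := by
      rw [Finset.filter_union, Finset.filter_congr fun v hv => by rw [hψK hv]]
      exact (Finset.card_union_le _ _).trans (by gcongr; exact Finset.filter_subset _ _)
    obtain ⟨x, hxD, hx_adj, hx_new⟩ := exists_adj_notMem_image (G := G) hparU hparw
      (by have := hdeg.1 _ hparw (fun h => (hψK h).symm); lia)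
    refine ⟨Function.update ψ w x, fun v hv => ?_, ?_, fun v hv => ?_⟩
    · rw [Function.update_of_ne (by rintro rfl; exact hKS.1 hv), hψK hv]
    · rw [Finset.union_insert]
      exact injOn_update_insert hψinj hx_new
    · rw [Function.update_of_ne (hne v hv)]
      obtain rfl | hvw := eq_or_ne v w
      · simpa using ⟨hxD, hx_adj.symm⟩
      · rw [Function.update_of_ne hvw]
        exact hψS v (Finset.mem_of_mem_insert_of_ne hv hvw)

lemma exists_greedy_branch {D : Finset V} {K S : Finset W} {t : W} (hφ : Set.InjOn φ K)
    (hKS : Disjoint K S) (ht : t ∈ K) (hKD : ∀ w ∈ K, φ w ∈ D ↔ w = t) (hroot : T.root ∉ S)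
    (hpar : ∀ w ∈ S, T.parent w ∈ insert t S) (hdeg : ∀ g ∈ D, S.card ≤ degIn G D g) :
    ∃ ψ : W → V, Set.EqOn ψ φ K ∧ Set.InjOn ψ (K ∪ S : Finset W) ∧
      ∀ w ∈ S, ψ w ∈ D ∧ G.Adj (ψ w) (ψ (T.parent w)) := by
  have hfilter : K.filter (φ · ∈ D) = {t} := by grind
  have hparK : ∀ w ∈ S, T.parent w ∈ K → T.parent w = t := fun w hw hwK =>
    (Finset.mem_insert.mp (hpar w hw)).resolve_right (Finset.disjoint_left.mp hKS hwK)
  refine exists_greedy_extension hφ S hKS hroot (by grind)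
    (fun w hw hwK => (hKD _ hwK).mpr (hparK w hw hwK)) fun w _ g hg _ => ?_
  have := hdeg g hg
  rw [hfilter, Finset.card_singleton]
  lia

lemma hasCopy_of_le_degIn [Fintype W] (hZ : Z.Nonempty)
    (hdeg : ∀ z ∈ Z, Fintype.card W ≤ degIn G Z z + 1) : T.HasCopy G Z := by
  obtain ⟨z₀, hz₀⟩ := hZ
  obtain ⟨ψ, hψ_root, hψ_inj, hψ⟩ := exists_greedy_branch (T := T) (G := G) (D := Z)
    (φ := fun _ => z₀) (K := {T.root}) (S := Finset.univ.erase T.root) (t := T.root)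
    (by simp) (by simp) (by simp) (by simp [hz₀]) (by simp) (by grind) fun g hg => by
      have := hdeg g hg
      rw [Finset.card_erase_of_mem (Finset.mem_univ _), Finset.card_univ]
      lia
  have huniv : ({T.root} ∪ Finset.univ.erase T.root : Finset W) = Finset.univ := by grind
  rw [huniv, Finset.coe_univ, Set.injOn_univ] at hψ_inj
  refine ⟨ψ, hψ_inj, fun w hw => (hψ w (by simp [hw])).2, fun w => ?_⟩
  obtain rfl | hw := eq_or_ne w T.root
  · rwa [hψ_root (by simp)]
  · exact (hψ w (by simp [hw])).1

variable [Fintype W]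

variable (T) in
/-- The proper descendants of `t`. -/
noncomputable def below (t : W) : Finset W := Finset.univ.filter fun w => T.Desc t w ∧ w ≠ t

lemma mem_below {t w : W} : w ∈ T.below t ↔ T.Desc t w ∧ w ≠ t := by simp [below]

lemma not_desc_of_notMem_below {t w : W} (h : w ∉ T.below t) (hwt : w ≠ t) : ¬ T.Desc t w :=
  fun htw => h (mem_below.mpr ⟨htw, hwt⟩)

lemma root_notMem_below (t : W) : T.root ∉ T.below t := fun h =>
  (mem_below.mp h).1.ne_root (mem_below.mp h).2 rfl

lemma parent_mem_insert_below {t w : W} (hw : w ∈ T.below t) :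
    T.parent w ∈ insert t (T.below t) := by
  rw [mem_below] at hw
  rw [Finset.mem_insert, mem_below, or_iff_not_imp_left]
  exact fun h => ⟨hw.1.parent hw.2, h⟩

lemma IsEmb.of_eqOn_update {Z' : Finset V} {ψ : W → V} {t : W} {z : V} (hφ : T.IsEmb G Z φ)
    (hψ : Set.EqOn ψ (Function.update φ t z) ((T.below t)ᶜ : Finset W))
    (hinj : Function.Injective ψ) (hz : z ∈ Z') (hzt : t ≠ T.root → G.Adj z (φ (T.parent t)))
    (hoff : ∀ w, ¬ T.Desc t w → φ w ∈ Z')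
    (hbelow : ∀ w ∈ T.below t, ψ w ∈ Z' ∧ G.Adj (ψ w) (ψ (T.parent w))) :
    T.IsEmb G Z' ψ ∧ ∀ w, ¬ T.Desc t w → ψ w = φ w := by
  have hψt : ψ t = z := (hψ (by simp [mem_below])).trans (Function.update_self ..)
  have hψ_off : ∀ w, ¬ T.Desc t w → ψ w = φ w := fun w hw => by
    rw [hψ (by simp [mem_below, hw]),
      Function.update_of_ne (by rintro rfl; exact hw (Desc.refl _))]
  refine ⟨⟨hinj, fun w hw => ?_, fun w => ?_⟩, hψ_off⟩
  · by_cases htw : T.Desc t w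
    · obtain rfl | hwt := eq_or_ne w t
      · rw [hψt, hψ_off _ (not_desc_parent hw)]
        exact hzt hw
      · exact (hbelow w (mem_below.mpr ⟨htw, hwt⟩)).2
    · rw [hψ_off w htw, hψ_off _ fun h => htw (h.trans (desc_parent hw))]
      exact hφ.adj w hw
  · by_cases hw : w ∈ T.below t
    · exact (hbelow w hw).1
    · obtain rfl | hwt := eq_or_ne w t
      · exact hψt ▸ hz
      · have htw := not_desc_of_notMem_below hw hwt
        exact hψ_off w htw ▸ hoff w htw

lemma IsEmb.exists_move_branch {A : Finset V} (hφ : T.IsEmb G Z φ) (hA : ∀ a ∈ A, ∃ w, φ w = a)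
    (hdeg : ∀ z ∈ Z, z ∉ A → Fintype.card W ≤ degIn G Z z)
    {t : W} (ht : t ≠ T.root) (htA : ∀ w, T.Desc t w → φ w ∉ A)
    {z : V} (hz : z ∈ Z) (hzφ : ∀ w, φ w ≠ z) (hadj : G.Adj z (φ (T.parent t))) :
    ∃ ψ, T.IsEmb G (Z.erase (φ t)) ψ ∧ ∀ w, ¬ T.Desc t w → ψ w = φ w := by
  set φ' := Function.update φ t z with hφ'
  set K := (T.below t)ᶜ with hK
  have hφ't : φ' t = z := Function.update_self ..
  have hinj : Function.Injective φ' := injective_update_of_forall_ne hφ.inj t hzφ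
  have htK : t ∈ K := by simp [hK, mem_below]
  have hzK : z ∈ K.image φ' := Finset.mem_image.mpr ⟨t, htK, hφ't⟩
  set D := insert z ((Z \ K.image φ').erase (φ t)) with hD
  have hDZ : D ⊆ Z.erase (φ t) := by
    have := hzφ t
    grind
  have hDA : ∀ g ∈ D, g ∉ A := by
    intro g hg hgA
    obtain ⟨w, rfl⟩ := hA g hgA
    have htw : ¬ T.Desc t w := fun h => htA w h hgA
    have hwt : w ≠ t := by rintro rfl; exact htw (Desc.refl _)
    have hwK : φ w ∈ K.image φ' :=
      Finset.mem_image.mpr ⟨w, by simp [hK, mem_below, htw], Function.update_of_ne hwt ..⟩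
    have := hzφ w
    grind
  have hcardK : (T.below t).card + K.card = Fintype.card W := Finset.card_add_card_compl _
  have hlost : (Z \ D).card ≤ K.card := by
    have hsub : Z \ D ⊆ insert (φ t) ((K.image φ').erase z) := by grind
    refine (Finset.card_le_card hsub).trans ((Finset.card_insert_le _ _).trans ?_)
    rw [Finset.card_erase_add_one hzK]
    exact Finset.card_image_le
  obtain ⟨ψ, hψK, hψinj, hψ⟩ := exists_greedy_branch (T := T) (G := G) (D := D)
    hinj.injOn disjoint_compl_left htK
    (fun w hw => ⟨fun hwD => hinj (by grind), by grind⟩)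
    (root_notMem_below t) (fun w => parent_mem_insert_below) fun g hg => by
      have := hdeg g (Finset.mem_of_mem_erase (hDZ hg)) (hDA g hg)
      have := degIn_le_add_card_sdiff (G := G) Z D g
      lia
  rw [Finset.union_comm, Finset.union_compl, Finset.coe_univ, Set.injOn_univ] at hψinj
  exact ⟨ψ, hφ.of_eqOn_update hψK hψinj (hDZ (Finset.mem_insert_self _ _)) (fun _ => hadj)
    (fun w hw => Finset.mem_erase.mpr
      ⟨hφ.inj.ne (by rintro rfl; exact hw (Desc.refl _)), hφ.mem w⟩)
    fun w hw => (hψ w hw).imp_left (hDZ ·)⟩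

lemma exists_extend_leaves {D : Finset V} {L : Finset W} {ψ : W → V}
    (hL : ∀ l ∈ L, T.IsLeaf l ∧ l ≠ T.root) (hψ : Set.InjOn ψ (Lᶜ : Finset W))
    (hparD : ∀ l ∈ L, ψ (T.parent l) ∈ D)
    (hdeg : ∀ l ∈ L, Fintype.card W ≤ degIn G D (ψ (T.parent l)) + 1) :
    ∃ χ : W → V, Set.EqOn χ ψ (Lᶜ : Finset W) ∧ Function.Injective χ ∧
      ∀ l ∈ L, χ l ∈ D ∧ G.Adj (χ l) (χ (T.parent l)) := by
  have hpar : ∀ l ∈ L, T.parent l ∈ Lᶜ := fun l hl =>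
    Finset.mem_compl.mpr fun h => (hL _ h).1 l (hL l hl).2 rfl
  have hcard := Finset.card_add_card_compl L
  obtain ⟨χ, hχ_eq, hχ_inj, hχ⟩ := exists_greedy_extension (T := T) (G := G) hψ L
    disjoint_compl_left (fun h => (hL _ h).2 rfl)
    (fun l hl => Finset.mem_union_left _ (hpar l hl)) (fun l hl _ => hparD l hl)
    fun l hl g _ hg => by
      have := hg (hpar l hl) ▸ hdeg l hl
      have := Finset.card_filter_le Lᶜ (ψ · ∈ D)
      lia
  rw [Finset.union_comm, Finset.union_compl, Finset.coe_univ, Set.injOn_univ] at hχ_inj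
  exact ⟨χ, hχ_eq, hχ_inj, hχ⟩

variable (T) in
/-- The proper descendants of `t` that have a child. -/
noncomputable def innerBelow (t : W) : Finset W := (T.below t).filter (¬ T.IsLeaf ·)

variable (T) in
/-- The leaves properly below `t`. -/
noncomputable def leavesBelow (t : W) : Finset W := (T.below t).filter T.IsLeaf

lemma mem_innerBelow {t w : W} : w ∈ T.innerBelow t ↔ w ∈ T.below t ∧ ¬ T.IsLeaf w :=
  Finset.mem_filter

lemma mem_leavesBelow {t w : W} : w ∈ T.leavesBelow t ↔ w ∈ T.below t ∧ T.IsLeaf w :=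
  Finset.mem_filter

lemma compl_below_union_innerBelow (t : W) :
    (T.below t)ᶜ ∪ T.innerBelow t = (T.leavesBelow t)ᶜ := by
  ext w
  simp only [Finset.mem_union, Finset.mem_compl, mem_innerBelow, mem_leavesBelow]
  tauto

lemma parent_mem_insert_innerBelow {t w : W} (hw : w ∈ T.below t) :
    T.parent w ∈ insert t (T.innerBelow t) := by
  have hw_root := (mem_below.mp hw).1.ne_root (mem_below.mp hw).2
  have := parent_mem_insert_below hw
  rw [Finset.mem_insert] at this ⊢
  exact this.imp_right fun h => mem_innerBelow.mpr ⟨h, fun hl => hl w hw_root rfl⟩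

/-- The inner vertices of the branch go into `Y`, and then its leaves anywhere in `D`. -/
lemma exists_rebuild_branch {Y D : Finset V} {y : W} (hφ : Function.Injective φ)
    (hYφ : ∀ w ∉ T.below y, φ w ∈ Y ↔ w = y) (hYD : Y ⊆ D)
    (hdegY : ∀ g ∈ Y, (T.innerBelow y).card ≤ degIn G Y g)
    (hdegD : ∀ g ∈ Y, Fintype.card W ≤ degIn G D g + 1) :
    ∃ χ : W → V, Set.EqOn χ φ ((T.below y)ᶜ : Finset W) ∧ Function.Injective χ ∧
      ∀ w ∈ T.below y, χ w ∈ D ∧ G.Adj (χ w) (χ (T.parent w)) := by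
  have hy : y ∈ (T.below y)ᶜ := by simp [mem_below]
  obtain ⟨ψ, hψ_eq, hψ_inj, hψ⟩ := exists_greedy_branch (T := T) (G := G) (D := Y)
    (S := T.innerBelow y) hφ.injOn (disjoint_compl_left.mono_right (Finset.filter_subset _ _)) hy
    (fun w hw => hYφ w (Finset.mem_compl.mp hw))
    (fun h => root_notMem_below y (mem_innerBelow.mp h).1)
    (fun w hw => parent_mem_insert_innerBelow (mem_innerBelow.mp hw).1) hdegY
  rw [compl_below_union_innerBelow] at hψ_inj
  have hψY : ∀ w ∈ insert y (T.innerBelow y), ψ w ∈ Y := by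
    rw [Finset.forall_mem_insert]
    exact ⟨hψ_eq hy ▸ (hYφ y (Finset.mem_compl.mp hy)).mpr rfl, fun w hw => (hψ w hw).1⟩
  have hparY : ∀ w ∈ T.below y, ψ (T.parent w) ∈ Y := fun w hw =>
    hψY _ (parent_mem_insert_innerBelow hw)
  obtain ⟨χ, hχ_eq, hχ_inj, hχ⟩ := exists_extend_leaves (T := T) (G := G) (D := D)
    (L := T.leavesBelow y) (fun l hl => by
      obtain ⟨hly, hl⟩ := mem_leavesBelow.mp hl
      exact ⟨hl, (mem_below.mp hly).1.ne_root (mem_below.mp hly).2⟩) hψ_inj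
    (fun l hl => hYD (hparY l (mem_leavesBelow.mp hl).1))
    fun l hl => hdegD _ (hparY l (mem_leavesBelow.mp hl).1)
  rw [← compl_below_union_innerBelow] at hχ_eq
  refine ⟨χ, fun w hw => (hχ_eq (Finset.mem_union_left _ hw)).trans (hψ_eq hw), hχ_inj,
    fun w hw => ?_⟩
  by_cases hleaf : T.IsLeaf w
  · exact hχ w (mem_leavesBelow.mpr ⟨hw, hleaf⟩)
  · have hw_inner := mem_innerBelow.mpr ⟨hw, hleaf⟩
    have hpar : χ (T.parent w) = ψ (T.parent w) := hχ_eq <| by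
      have := parent_mem_insert_innerBelow hw
      grind
    rw [hpar, hχ_eq (Finset.mem_union_right _ hw_inner)]
    exact (hψ w hw_inner).imp_left (hYD ·)

lemma IsEmb.hasCopy_erase_of_branch {Y : Finset V} {y w₀ : W} {f : V}
    (hφ : T.IsEmb G (Z.erase f) φ) (hyf : y ≠ T.root → G.Adj f (φ (T.parent y)))
    (hw₀ : T.Desc y w₀) (hw₀Y : φ w₀ ∉ Y) (hYZ : Y ⊆ Z) (hYφ : ∀ w, ¬ T.Desc y w → φ w ∉ Y)
    (hfY : f ∈ Y) (hdeg : ∀ z ∈ Y, Fintype.card W ≤ degIn G Z z)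
    (hdegY : ∀ g ∈ Y, (T.innerBelow y).card ≤ degIn G Y g) :
    T.HasCopy G (Z.erase (φ w₀)) := by
  have hYZ₀ : Y ⊆ Z.erase (φ w₀) := fun z hz =>
    Finset.mem_erase.mpr ⟨by rintro rfl; exact hw₀Y hz, hYZ hz⟩
  have hlost : (Z \ Z.erase (φ w₀)).card ≤ 1 :=
    Finset.card_le_card (t := {φ w₀}) (by grind)
  obtain ⟨χ, hχ_eq, hχ_inj, hχ⟩ := exists_rebuild_branch (T := T) (G := G) (y := y)
    (φ := Function.update φ y f) (injective_update_of_forall_ne hφ.inj y hφ.ne_of_erase)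
    (fun w hw => by
      obtain rfl | hwy := eq_or_ne w y
      · simpa using hfY
      · simpa [hwy] using hYφ w (not_desc_of_notMem_below hw hwy)) hYZ₀ hdegY
    fun g hg => (hdeg g hg).trans ((degIn_le_add_card_sdiff Z _ g).trans (by gcongr))
  exact ⟨χ, (hφ.of_eqOn_update hχ_eq hχ_inj (hYZ₀ hfY) hyf (fun w hw => Finset.mem_erase.mpr
    ⟨hφ.inj.ne (by rintro rfl; exact hw hw₀), Finset.mem_of_mem_erase (hφ.mem w)⟩) hχ).1⟩

lemma IsEmb.exists_free_adj (hφ : T.IsEmb G Z φ) {u : W}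
    (hdeg : Fintype.card W ≤ degIn G Z (φ u)) :
    ∃ z ∈ Z, (∀ w, φ w ≠ z) ∧ G.Adj (φ u) z := by
  obtain ⟨z, hz, hadj, hne⟩ := exists_adj_notMem_image (G := G) (Finset.mem_univ u) (hφ.mem u)
    ((Finset.card_filter_le _ _).trans hdeg)
  exact ⟨z, hz, fun w => hne w (Finset.mem_univ w), hadj⟩

lemma exists_mem_forall_ne (φ : W → V) (hcard : Fintype.card W < Z.card) :
    ∃ f ∈ Z, ∀ w, φ w ≠ f := by
  obtain ⟨f, hfZ, hf⟩ := Finset.exists_mem_notMem_of_card_lt_card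
    (Finset.card_image_le.trans_lt hcard : (Finset.univ.image φ).card < Z.card)
  exact ⟨f, hfZ, fun w hw => hf (Finset.mem_image.mpr ⟨w, Finset.mem_univ w, hw⟩)⟩

/-- Childless vertices of `Q` are incomparable, so leaves chosen below them are distinct. -/
lemma card_filter_childless_le {Q : Finset W} (y : W)
    (hQ : ∀ w ∈ Q, w ≠ T.root → T.parent w ∈ Q) :
    (Q.filter fun c => T.Desc y c ∧ ∀ t ∈ Q, t ≠ T.root → T.parent t ≠ c).card ≤
      (Finset.univ.filter fun l => T.Desc y l ∧ T.IsLeaf l).card := by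
  have hup : ∀ c d, T.Desc c d → d ∈ Q → c ∈ Q := by
    intro c d h
    induction h with
    | refl => exact id
    | tail _ h ih => exact fun hd => ih (h.2 ▸ hQ _ hd h.1)
  have hanti : ∀ c d, d ∈ Q → (∀ t ∈ Q, t ≠ T.root → T.parent t ≠ c) → T.Desc c d → c = d := by
    intro c d hd hc hcd
    by_contra hne
    obtain ⟨e, he, hec, hed⟩ := hcd.exists_child (Ne.symm hne)
    exact hc e (hup e d hed hd) he hec
  choose leaf hdesc hleaf using exists_isLeaf_desc (T := T)
  refine Finset.card_le_card_of_injOn leaf (fun c hc => ?_) fun c hc d hd hcd => ?_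
  · obtain ⟨-, hyc, -⟩ := Finset.mem_filter.mp (Finset.mem_coe.mp hc)
    simpa using ⟨hyc.trans (hdesc c), hleaf c⟩
  · obtain ⟨hcQ, -, hc⟩ := Finset.mem_filter.mp (Finset.mem_coe.mp hc)
    obtain ⟨hdQ, -, hd⟩ := Finset.mem_filter.mp (Finset.mem_coe.mp hd)
    rcases (hdesc c).total (hcd ▸ hdesc d : T.Desc d (leaf c)) with h | h
    exacts [hanti c d hdQ hc h, (hanti d c hcQ hd h).symm]

lemma card_innerBelow_add_le (y : W) :
    (T.innerBelow y).card + (Finset.univ.filter fun l => T.Desc y l ∧ T.IsLeaf l).card ≤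
      (Finset.univ.filter (T.Desc y)).card := by
  rw [← Finset.card_union_of_disjoint]
  · refine Finset.card_le_card fun w hw => ?_
    simp only [Finset.mem_union, mem_innerBelow, mem_below, Finset.mem_filter_univ] at hw ⊢
    tauto
  · rw [Finset.disjoint_left]
    intro w hw hw'
    exact (mem_innerBelow.mp hw).2 (Finset.mem_filter.mp hw').2.2

/-- Below `y` only the images of childless vertices of `Q` can be neighbours of `g`, and these are
no more than the leaves. -/
lemma card_innerBelow_le_degIn_sdiff {Q : Finset W} {y : W} {g : V}
    (hQ : ∀ w ∈ Q, w ≠ T.root → T.parent w ∈ Q) (hdeg : Fintype.card W ≤ degIn G Z g)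
    (hmiss : ∀ t ∈ Q, t ≠ T.root → T.Desc y (T.parent t) → ¬ G.Adj g (φ (T.parent t))) :
    (T.innerBelow y).card ≤ degIn G (Z \ Q.image φ) g := by
  set B := Finset.univ.filter (T.Desc y) with hB
  set C := Q.filter fun c => T.Desc y c ∧ ∀ t ∈ Q, t ≠ T.root → T.parent t ≠ c with hC
  have hsub : Z.filter (G.Adj g) ⊆ (Z \ Q.image φ).filter (G.Adj g) ∪ (Bᶜ ∪ C).image φ := by
    intro x hx
    obtain ⟨hxZ, hgx⟩ := Finset.mem_filter.mp hx
    by_cases hxQ : x ∈ Q.image φ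
    · obtain ⟨q, hq, rfl⟩ := Finset.mem_image.mp hxQ
      refine Finset.mem_union_right _ (Finset.mem_image_of_mem _ ?_)
      by_cases hyq : T.Desc y q
      · refine Finset.mem_union_right _ (Finset.mem_filter.mpr ⟨hq, hyq, ?_⟩)
        rintro t htQ ht rfl
        exact hmiss t htQ ht hyq hgx
      · simp [hB, hyq]
    · simp [hxZ, hgx, hxQ]
  have hcard : degIn G Z g ≤ degIn G (Z \ Q.image φ) g + (Bᶜ.card + C.card) :=
    (Finset.card_le_card hsub).trans <| (Finset.card_union_le _ _).trans <| by
      gcongr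
      exacts [le_rfl, Finset.card_image_le.trans (Finset.card_union_le _ _)]
  have hBc : B.card + Bᶜ.card = Fintype.card W := Finset.card_add_card_compl B
  have hCL := card_filter_childless_le y hQ
  have hinner := card_innerBelow_add_le (T := T) y
  rw [← hC] at hCL
  rw [← hB] at hinner
  lia

variable (T G) in
/-- `y` can be moved to the free vertex `f` of `Z`, and the branch at `y` meets `A`. -/
structure IsMovable (Z A : Finset V) (y : W) (φ : W → V) (f : V) : Prop where
  isEmb : T.IsEmb G (Z.erase f) φ
  mem : f ∈ Z
  adj_parent : y ≠ T.root → G.Adj f (φ (T.parent y))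
  exists_desc : ∃ w, T.Desc y w ∧ φ w ∈ A

variable (T G) in
/-- A subtree `Q` that contains everything off the branch at `y` and everything mapped into `A`, and
each of whose missing vertices can be freed without moving `Q`. -/
structure IsCore (Z A : Finset V) (y : W) (φ : W → V) (Q : Finset W) : Prop where
  mem_of_not_desc : ∀ w, ¬ T.Desc y w → w ∈ Q
  parent_mem : ∀ w ∈ Q, w ≠ T.root → T.parent w ∈ Q
  mem_of_mem : ∀ w, φ w ∈ A → w ∈ Q
  exists_emb : ∀ t ∉ Q, ∃ ψ, T.IsEmb G (Z.erase (φ t)) ψ ∧ Set.EqOn ψ φ Q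

variable {A : Finset V} {y : W} {Q : Finset W}

omit [Fintype W] in
lemma IsCore.exists_emb_erase (hQ : T.IsCore G Z A y φ Q) (hφ : T.IsEmb G Z φ) {z : V}
    (hz : z ∉ Q.image φ) : ∃ ψ, T.IsEmb G (Z.erase z) ψ ∧ Set.EqOn ψ φ Q := by
  by_cases h : ∃ t, φ t = z
  · obtain ⟨t, rfl⟩ := h
    exact hQ.exists_emb t fun ht => hz (Finset.mem_image_of_mem _ ht)
  · push Not at h
    exact ⟨φ, hφ.erase h, Set.eqOn_refl _ _⟩

omit [Fintype W] in
lemma IsCore.erase (hQ : T.IsCore G Z A y φ Q) {s : W} (hys : T.Desc y s) (hsA : φ s ∉ A)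
    (hs : ∀ w ∈ Q, T.Desc s w → w = s)
    (hfree : ∃ ψ, T.IsEmb G (Z.erase (φ s)) ψ ∧ Set.EqOn ψ φ (Q.erase s : Finset W)) :
    T.IsCore G Z A y φ (Q.erase s) where
  mem_of_not_desc w hw :=
    Finset.mem_erase.mpr ⟨by rintro rfl; exact hw hys, hQ.mem_of_not_desc w hw⟩
  parent_mem w hw hw_root := by
    obtain ⟨hws, hwQ⟩ := Finset.mem_erase.mp hw
    exact Finset.mem_erase.mpr
      ⟨fun h => hws (hs w hwQ (h ▸ desc_parent hw_root)), hQ.parent_mem w hwQ hw_root⟩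
  mem_of_mem w hw := Finset.mem_erase.mpr ⟨by rintro rfl; exact hsA hw, hQ.mem_of_mem w hw⟩
  exists_emb t ht := by
    obtain rfl | hts := eq_or_ne t s
    · exact hfree
    · obtain ⟨ψ, hψ, hψ_eq⟩ := hQ.exists_emb t fun h => ht (Finset.mem_erase.mpr ⟨hts, h⟩)
      exact ⟨ψ, hψ, hψ_eq.mono (Finset.coe_subset.mpr (Finset.erase_subset _ _))⟩

/-- Take `s` deepest in `Q` below `n`: its branch moves to a free neighbour of its parent. -/
lemma IsCore.exists_isCore_erase (hQ : T.IsCore G Z A y φ Q) (hφ : T.IsEmb G Z φ)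
    (hA : ∀ φ, T.IsEmb G Z φ → ∀ a ∈ A, ∃ w, φ w = a)
    (hdeg : ∀ z ∈ Z, z ∉ A → Fintype.card W ≤ degIn G Z z) {z : V} (hz : z ∈ Z)
    (hzQ : z ∉ Q.image φ) {n : W} (hyn : T.Desc y n) (hzn : G.Adj z (φ n))
    (hchild : ∃ t ∈ Q, t ∈ T.below n) (hnA : ∀ w ∈ T.below n, φ w ∉ A) :
    ∃ s ∈ Q, T.IsCore G Z A y φ (Q.erase s) := by
  obtain ⟨ψ, hψ_erase, hψ_eq⟩ := hQ.exists_emb_erase hφ hzQ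
  have hψ := hψ_erase.mono (Finset.erase_subset _ _)
  obtain ⟨t, ht⟩ := hchild
  obtain ⟨s, hs, hsmax⟩ := Finset.exists_max_image (Q.filter (· ∈ T.below n)) T.depth
    ⟨t, Finset.mem_filter.mpr ht⟩
  obtain ⟨hsQ, hsn⟩ := Finset.mem_filter.mp hs
  obtain ⟨hns, hsn_ne⟩ := mem_below.mp hsn
  have hs_root := hns.ne_root hsn_ne
  have hs_bot : ∀ w ∈ Q, T.Desc s w → w = s := by
    intro w hw hsw
    by_contra hne
    have hdepth := hsw.depth_lt hne
    have hwn : w ≠ n := by rintro rfl; exact hdepth.not_ge hns.depth_le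
    exact hdepth.not_ge
      (hsmax w (Finset.mem_filter.mpr ⟨hw, mem_below.mpr ⟨hns.trans hsw, hwn⟩⟩))
  have hpar_eq : ψ (T.parent s) = φ (T.parent s) := hψ_eq (hQ.parent_mem s hsQ hs_root)
  obtain ⟨z', hz', hz'ψ, hz'_adj⟩ : ∃ z' ∈ Z, (∀ w, ψ w ≠ z') ∧ G.Adj (ψ (T.parent s)) z' := by
    rcases Finset.mem_insert.mp (parent_mem_insert_below hsn) with hp | hp
    · exact ⟨z, hz, hψ_erase.ne_of_erase, by rw [hpar_eq, hp]; exact hzn.symm⟩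
    · exact hψ.exists_free_adj (hdeg _ (hψ.mem _) (hpar_eq ▸ hnA _ hp))
  obtain ⟨ψ', hψ', hψ'_eq⟩ := hψ.exists_move_branch (hA ψ hψ) hdeg hs_root
    (fun w hsw hwA => by
      obtain ⟨v, hv⟩ := hA φ hφ _ hwA
      have hvA : φ v ∈ A := hv ▸ hwA
      have hvw : v = w := hψ.inj ((hψ_eq (hQ.mem_of_mem v hvA)).trans hv)
      exact hnA s hsn (hs_bot v (hQ.mem_of_mem v hvA) (hvw ▸ hsw) ▸ hvA))
    hz' hz'ψ hz'_adj.symm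
  refine ⟨s, hsQ, hQ.erase (hyn.trans hns) (hnA s hsn) hs_bot ⟨ψ', hψ_eq hsQ ▸ hψ', fun w hw => ?_⟩⟩
  obtain ⟨hws, hwQ⟩ := Finset.mem_erase.mp hw
  rw [hψ'_eq w fun h => hws (hs_bot w hwQ h), hψ_eq hwQ]

/-- Adjacency to `φ n` would let a child of `n`, deeper than `y`, be moved, or shrink `Q`. -/
lemma IsCore.not_adj (hQ : T.IsCore G Z A y φ Q) (hφ : T.IsEmb G Z φ)
    (hA : ∀ φ, T.IsEmb G Z φ → ∀ a ∈ A, ∃ w, φ w = a)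
    (hdeg : ∀ z ∈ Z, z ∉ A → Fintype.card W ≤ degIn G Z z)
    (hdeepest : ∀ y' φ' f', T.IsMovable G Z A y' φ' f' → T.depth y' ≤ T.depth y)
    (hmin : ∀ s ∈ Q, ¬ T.IsCore G Z A y φ (Q.erase s))
    {z : V} (hz : z ∈ Z \ Q.image φ) {t : W} (htQ : t ∈ Q) (ht : t ≠ T.root)
    (hyt : T.Desc y (T.parent t)) : ¬ G.Adj z (φ (T.parent t)) := by
  intro hadj
  obtain ⟨hzZ, hzQ⟩ := Finset.mem_sdiff.mp hz
  have htn : t ∈ T.below (T.parent t) :=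
    mem_below.mpr ⟨desc_parent ht, fun h => not_desc_parent ht (h ▸ Desc.refl t)⟩
  by_cases hb : ∃ w ∈ T.below (T.parent t), φ w ∈ A
  · obtain ⟨w, hw, hwA⟩ := hb
    obtain ⟨c, hc, hct, hcw⟩ := (mem_below.mp hw).1.exists_child (mem_below.mp hw).2
    obtain ⟨ψ, hψ, hψ_eq⟩ := hQ.exists_emb_erase hφ hzQ
    have hpar_eq : ψ (T.parent c) = φ (T.parent t) :=
      hct ▸ hψ_eq (hct ▸ hQ.parent_mem t htQ ht)
    have hc_movable : T.IsMovable G Z A c ψ z :=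
      ⟨hψ, hzZ, fun _ => hpar_eq ▸ hadj, w, hcw, (hψ_eq (hQ.mem_of_mem w hwA)).symm ▸ hwA⟩
    exact (hyt.depth_le.trans_lt (hct ▸ T.depth_parent_lt c hc)).not_ge
      (hdeepest c ψ z hc_movable)
  · push Not at hb
    obtain ⟨s, hsQ, hs⟩ :=
      hQ.exists_isCore_erase hφ hA hdeg hzZ hzQ hyt hadj ⟨t, htQ, htn⟩ hb
    exact hmin s hsQ hs

theorem exists_hasCopy_erase (hA : A.Nonempty) (hT : T.HasCopy G Z)
    (hcard : Fintype.card W < Z.card)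
    (hdeg : ∀ z ∈ Z, z ∉ A → Fintype.card W ≤ degIn G Z z) :
    ∃ a ∈ A, T.HasCopy G (Z.erase a) := by
  by_contra! hcon
  have hcover : ∀ φ, T.IsEmb G Z φ → ∀ a ∈ A, ∃ w, φ w = a := by
    intro φ hφ a ha
    by_contra! h
    exact hcon a ha ⟨φ, hφ.erase h⟩
  have hroot : ∃ φ f, T.IsMovable G Z A T.root φ f := by
    obtain ⟨φ, hφ⟩ := hT
    obtain ⟨f, hf, hfφ⟩ := exists_mem_forall_ne φ hcard
    obtain ⟨a, ha⟩ := hA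
    obtain ⟨w, rfl⟩ := hcover φ hφ a ha
    exact ⟨φ, f, hφ.erase hfφ, hf, fun h => absurd rfl h, w, desc_root w, ha⟩
  obtain ⟨y, ⟨φ, f, hy⟩, hdeepest⟩ := Set.exists_max_image
    {y | ∃ φ f, T.IsMovable G Z A y φ f} T.depth (Set.toFinite _) ⟨T.root, hroot⟩
  obtain ⟨Q, hQ, hQmin⟩ := Set.exists_min_image {Q | T.IsCore G Z A y φ Q} Finset.card
    (Set.toFinite _) ⟨Finset.univ, by simp, by simp, by simp, by simp⟩
  have hφ := hy.isEmb.mono (Finset.erase_subset _ _)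
  have hYdeg : ∀ z ∈ Z \ Q.image φ, Fintype.card W ≤ degIn G Z z := by
    intro z hz
    obtain ⟨hzZ, hzQ⟩ := Finset.mem_sdiff.mp hz
    refine hdeg z hzZ fun hzA => ?_
    obtain ⟨w, rfl⟩ := hcover φ hφ z hzA
    exact hzQ (Finset.mem_image_of_mem _ (hQ.mem_of_mem w hzA))
  obtain ⟨w₀, hw₀, hw₀A⟩ := hy.exists_desc
  have hQ_image : ∀ w ∈ Q, φ w ∉ Z \ Q.image φ := fun w hw h =>
    (Finset.mem_sdiff.mp h).2 (Finset.mem_image_of_mem _ hw)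
  refine hcon _ hw₀A (hy.isEmb.hasCopy_erase_of_branch hy.adj_parent hw₀
    (hQ_image w₀ (hQ.mem_of_mem w₀ hw₀A)) Finset.sdiff_subset
    (fun w hw => hQ_image w (hQ.mem_of_not_desc w hw)) ?_ hYdeg fun g hg => ?_)
  · refine Finset.mem_sdiff.mpr ⟨hy.mem, fun h => ?_⟩
    obtain ⟨w, -, hw⟩ := Finset.mem_image.mp h
    exact hy.isEmb.ne_of_erase w hw
  · exact card_innerBelow_le_degIn_sdiff hQ.parent_mem (hYdeg g hg) fun t htQ ht hyt =>
      hQ.not_adj hφ hcover hdeg (fun y' φ' f' h => hdeepest y' ⟨φ', f', h⟩)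
        (fun s hs h => (Finset.card_erase_lt_of_mem hs).not_ge (hQmin _ h)) hg htQ ht hyt

end ParentTree

/-! ### Reachability inside a vertex set, inseparable sets -/

/-- The elements of `K` that are in the relation `r` to an element of `D`. -/
noncomputable def attached (r : V → V → Prop) (D K : Finset V) : Finset V :=
  K.filter fun k => ∃ d ∈ D, r d k

lemma mem_attached {r : V → V → Prop} {D K : Finset V} {k : V} :
    k ∈ attached r D K ↔ k ∈ K ∧ ∃ d ∈ D, r d k :=
  Finset.mem_filter

variable (G) in
/-- The vertices of `X` outside `D` with a neighbour in `D`. -/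
noncomputable def bdry (X D : Finset V) : Finset V := attached G.Adj D (X \ D)

lemma mem_bdry {X D : Finset V} {x : V} :
    x ∈ bdry G X D ↔ (x ∈ X ∧ x ∉ D) ∧ ∃ d ∈ D, G.Adj d x := by
  rw [bdry, mem_attached, Finset.mem_sdiff]

variable (G) in
/-- There is a walk from `a` to `b` all of whose vertices lie in `Y`; moreover every vertex is
reachable from itself, whether or not it belongs to `Y`. -/
def ReachableIn (Y : Finset V) : V → V → Prop :=
  Relation.ReflTransGen fun x y => x ∈ Y ∧ y ∈ Y ∧ G.Adj x y

variable (G) in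
/-- The subgraph induced on `R` is connected or empty. -/
def ConnOn (R : Finset V) : Prop :=
  ∀ a ∈ R, ∀ b ∈ R, ReachableIn G R a b

variable (G) in
/-- The connected component of `a` in the subgraph induced on `Y`, provided that `a ∈ Y`. -/
noncomputable def component (Y : Finset V) (a : V) : Finset V := Y.filter (ReachableIn G Y a)

variable (G) in
/-- No two vertices of `K` are separated by fewer than `k` vertices in the subgraph induced
on `X`. -/
def Insep (k : ℕ) (K X : Finset V) : Prop :=
  K ⊆ X ∧ ∀ S : Finset V, S.card < k → ∀ a ∈ K \ S, ∀ b ∈ K \ S, ReachableIn G (X \ S) a b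

variable (G) in
/-- Fewer than `k` vertices do not separate `t` from `N` in the subgraph induced on `Y`; by Menger's
theorem this means that `Y` contains `k` paths from `t` to `N` that are disjoint apart
from `t`. -/
def IsFanCenter (k : ℕ) (Y N : Finset V) (t : V) : Prop :=
  ∀ S : Finset V, S.card < k → t ∉ S → ∃ n ∈ N \ S, ReachableIn G (Y \ S) t n

section Reachability

variable {Y Y' R R' S E K X Q D N : Finset V} {a b c x y z : V} {k : ℕ}

lemma ReachableIn.mono (h : ReachableIn G Y a b) (hY : Y ⊆ Y') : ReachableIn G Y' a b :=
  Relation.ReflTransGen.mono (fun _ _ h => ⟨hY h.1, hY h.2.1, h.2.2⟩) _ _ h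

lemma ReachableIn.trans (hab : ReachableIn G Y a b) (hbc : ReachableIn G Y b c) :
    ReachableIn G Y a c :=
  Relation.ReflTransGen.trans hab hbc

lemma ReachableIn.symm (h : ReachableIn G Y a b) : ReachableIn G Y b a :=
  have : Std.Symm fun x y => x ∈ Y ∧ y ∈ Y ∧ G.Adj x y := ⟨fun _ _ h => ⟨h.2.1, h.1, h.2.2.symm⟩⟩
  Relation.ReflTransGen.stdSymm.symm _ _ h

lemma reachableIn_of_adj (hx : x ∈ Y) (hy : y ∈ Y) (h : G.Adj x y) : ReachableIn G Y x y :=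
  .single ⟨hx, hy, h⟩

/-- A walk is rerouted around `E` by joining the vertices at which it enters and leaves `E`. -/
lemma ReachableIn.reroute (h : ReachableIn G Y a b) (ha : a ∉ E) (hb : b ∉ E) (hY : Y \ E ⊆ Y')
    (hE : ∀ s ∈ bdry G Y E, ∀ s' ∈ bdry G Y E, ReachableIn G Y' s s') : ReachableIn G Y' a b := by
  suffices h : (b ∉ E → ReachableIn G Y' a b) ∧
      (b ∈ E → ∃ s ∈ bdry G Y E, ReachableIn G Y' a s) from h.1 hb
  clear hb
  induction h with
  | refl => exact ⟨fun _ => .refl, fun h => absurd h ha⟩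
  | @tail x y _ hxy ih =>
    obtain ⟨hx, hy, hadj⟩ := hxy
    have hmem : ∀ v ∈ Y, v ∉ E → v ∈ Y' := fun v hv hvE => hY (Finset.mem_sdiff.mpr ⟨hv, hvE⟩)
    by_cases hxE : x ∈ E <;> by_cases hyE : y ∈ E
    · exact ⟨fun h => absurd hyE h, fun _ => ih.2 hxE⟩
    · obtain ⟨s, hs, has⟩ := ih.2 hxE
      exact ⟨fun _ => has.trans (hE s hs y (mem_bdry.mpr ⟨⟨hy, hyE⟩, x, hxE, hadj⟩)),
        fun h => absurd h hyE⟩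
    · exact ⟨fun h => absurd hyE h,
        fun _ => ⟨x, mem_bdry.mpr ⟨⟨hx, hxE⟩, y, hyE, hadj.symm⟩, ih.1 hxE⟩⟩
    · exact ⟨fun _ => (ih.1 hxE).trans
        (reachableIn_of_adj (hmem x hx hxE) (hmem y hy hyE) hadj), fun h => absurd h hyE⟩

lemma ReachableIn.sdiff_of_card_bdry_le_one (h : ReachableIn G Y a b) (ha : a ∉ E) (hb : b ∉ E)
    (hE : (bdry G Y E).card ≤ 1) : ReachableIn G (Y \ E) a b :=
  h.reroute ha hb Finset.Subset.rfl fun s hs s' hs' =>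
    Finset.card_le_one.mp hE s hs s' hs' ▸ .refl

lemma connOn_singleton (z : V) : ConnOn G {z} := by
  intro a ha b hb
  rw [Finset.mem_singleton.mp ha, Finset.mem_singleton.mp hb]
  exact .refl

lemma ConnOn.union (hR : ConnOn G R) (hR' : ConnOn G R') (hz : z ∈ R) (hz' : z ∈ R') :
    ConnOn G (R ∪ R') := by
  have hreach : ∀ a ∈ R ∪ R', ReachableIn G (R ∪ R') a z := fun a ha =>
    (Finset.mem_union.mp ha).elim (fun ha => (hR a ha z hz).mono Finset.subset_union_left)
      (fun ha => (hR' a ha z hz').mono Finset.subset_union_right)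
  exact fun a ha b hb => (hreach a ha).trans (hreach b hb).symm

lemma connOn_pair (h : G.Adj x y) : ConnOn G {x, y} := by
  have hxy : ReachableIn G {x, y} x y := reachableIn_of_adj (by simp) (by simp) h
  intro a ha b hb
  simp only [Finset.mem_insert, Finset.mem_singleton] at ha hb
  rcases ha with rfl | rfl <;> rcases hb with rfl | rfl
  exacts [.refl, hxy, hxy.symm, .refl]

lemma ConnOn.union_of_adj (hR : ConnOn G R) (hR' : ConnOn G R') (hx : x ∈ R) (hy : y ∈ R')
    (hxy : G.Adj x y) : ConnOn G (R ∪ R') := by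
  have h := (hR.union (connOn_pair hxy) hx (by simp)).union hR' (z := y) (by simp) hy
  rwa [show R ∪ {x, y} ∪ R' = R ∪ R' by grind] at h

lemma ConnOn.insert_of_adj (hR : ConnOn G R) (hx : x ∈ R) (hxy : G.Adj x y) :
    ConnOn G (insert y R) := by
  rw [Finset.insert_eq, Finset.union_comm]
  exact hR.union_of_adj (connOn_singleton y) hx (Finset.mem_singleton_self y) hxy

lemma connOn_component : ConnOn G (component G Y a) := by
  suffices h : ∀ b ∈ component G Y a, ReachableIn G (component G Y a) a b from
    fun b hb c hc => (h b hb).symm.trans (h c hc)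
  intro b hb
  induction (Finset.mem_filter.mp hb).2 with
  | refl => exact .refl
  | @tail x y hax hxy ih =>
    have hx : x ∈ component G Y a := Finset.mem_filter.mpr ⟨hxy.1, hax⟩
    exact (ih hx).tail ⟨hx, hb, hxy.2.2⟩

lemma component_subset : component G Y a ⊆ Y := Finset.filter_subset _ _

lemma mem_component_self (ha : a ∈ Y) : a ∈ component G Y a := Finset.mem_filter.mpr ⟨ha, .refl⟩

lemma bdry_component_subset : bdry G X (component G (X \ S) a) ⊆ S := by
  intro y hy
  obtain ⟨⟨hyX, hy⟩, x, hx, hxy⟩ := mem_bdry.mp hy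
  obtain ⟨hxY, hax⟩ := Finset.mem_filter.mp hx
  by_contra hyS
  have hyY := Finset.mem_sdiff.mpr ⟨hyX, hyS⟩
  exact hy (Finset.mem_filter.mpr ⟨hyY, hax.trans (reachableIn_of_adj hxY hyY hxy)⟩)

lemma ConnOn.exists_adj (hR : ConnOn G R) (hY : Y ⊆ R) (hne : Y.Nonempty) (hYR : Y ≠ R) :
    ∃ l ∈ Y, ∃ x ∈ R, x ∉ Y ∧ G.Adj l x := by
  by_contra! hcon
  obtain ⟨a, ha⟩ := hne
  refine hYR (Finset.Subset.antisymm hY fun b hb => ?_)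
  have h := hR a (hY ha) b hb
  clear hb
  induction h with
  | refl => exact ha
  | tail _ hxy ih => exact by_contra fun hyY => hcon _ ih _ hxy.2.1 hyY hxy.2.2

lemma ConnOn.exists_erase (hR : ConnOn G R) {r : V} (hr : r ∈ R) (hne : R ≠ {r}) :
    ∃ x ∈ R, x ≠ r ∧ ConnOn G (R.erase x) := by
  obtain ⟨P, ⟨hPR, hrP, hP, hPne⟩, hmax⟩ := Set.exists_max_image
    {P | P ⊆ R ∧ r ∈ P ∧ ConnOn G P ∧ P ≠ R} Finset.card
    (R.powerset.finite_toSet.subset fun P hP => Finset.mem_powerset.mpr hP.1)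
    ⟨{r}, by simpa, by simp, connOn_singleton r, hne.symm⟩
  obtain ⟨l, hl, x, hx, hxP, hlx⟩ := hR.exists_adj hPR ⟨r, hrP⟩ hPne
  have hinsert : insert x P = R := by
    by_contra hcon
    have := hmax (insert x P) ⟨Finset.insert_subset hx hPR, Finset.mem_insert_of_mem hrP,
      hP.insert_of_adj hl hlx, hcon⟩
    rw [Finset.card_insert_of_notMem hxP] at this
    lia
  refine ⟨x, hx, fun h => hxP (h ▸ hrP), ?_⟩
  rwa [← hinsert, Finset.erase_insert hxP]

lemma ConnOn.erase_of_degIn_le_one (hR : ConnOn G R) (hz : degIn G R z ≤ 1) :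
    ConnOn G (R.erase z) := by
  intro a ha b hb
  have hcard : (bdry G R {z}).card ≤ 1 := (Finset.card_le_card fun x hx => by
    obtain ⟨⟨hxR, -⟩, d, hd, hdx⟩ := mem_bdry.mp hx
    exact Finset.mem_filter.mpr ⟨hxR, Finset.mem_singleton.mp hd ▸ hdx⟩).trans hz
  rw [Finset.erase_eq]
  exact (hR a (Finset.mem_of_mem_erase ha) b (Finset.mem_of_mem_erase hb)).sdiff_of_card_bdry_le_one
    (by grind) (by grind) hcard

lemma ReachableIn.exists_connOn_degIn_le_one (h : ReachableIn G R z a) (hz : z ∈ R) :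
    ∃ P ⊆ R, z ∈ P ∧ a ∈ P ∧ ConnOn G P ∧ degIn G P z ≤ 1 := by
  induction h with
  | refl => exact ⟨{z}, by simpa, by simp, by simp, connOn_singleton z,
      Finset.card_filter_le _ _⟩
  | @tail x y _ hxy ih =>
    obtain ⟨P, hPR, hzP, hxP, hP, hdeg⟩ := ih
    by_cases hzy : G.Adj z y
    · refine ⟨{z, y}, by grind, by simp, by simp, connOn_pair hzy, ?_⟩
      simp [degIn, Finset.filter_insert, Finset.filter_singleton, hzy]
    · refine ⟨insert y P, by grind, by simp [hzP], by simp, hP.insert_of_adj hxP hxy.2.2, ?_⟩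
      rwa [degIn, Finset.filter_insert, if_neg hzy]

lemma ConnOn.exists_fan (hR : ConnOn G R) (hz : z ∈ R) (r : V → V → Prop) (S : Finset V)
    (hS : ∀ s ∈ S, ∃ x ∈ R, r x s) :
    ∃ P ⊆ R, z ∈ P ∧ ConnOn G P ∧ (∀ s ∈ S, ∃ p ∈ P, r p s) ∧
      degIn G P z + (S.filter (r z)).card ≤ S.card := by
  induction S using Finset.induction_on with
  | empty => exact ⟨{z}, by simpa, by simp, connOn_singleton z, by simp, by simp [degIn]⟩
  | insert s S hs ih =>
    obtain ⟨P, hPR, hzP, hP, hPS, hcard⟩ := ih fun t ht => hS t (Finset.mem_insert_of_mem ht)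
    rw [Finset.card_insert_of_notMem hs, Finset.filter_insert]
    by_cases hzs : r z s
    · refine ⟨P, hPR, hzP, hP, by grind, ?_⟩
      rw [if_pos hzs, Finset.card_insert_of_notMem (by simp [hs])]
      lia
    · obtain ⟨x, hx, hxs⟩ := hS s (Finset.mem_insert_self ..)
      obtain ⟨P', hP'R, hzP', hxP', hP', hdeg⟩ := (hR z hz x hx).exists_connOn_degIn_le_one hz
      refine ⟨P ∪ P', Finset.union_subset hPR hP'R, Finset.mem_union_left _ hzP,
        hP.union hP' hzP hzP', by grind, ?_⟩
      have := degIn_union_le (G := G) P P' z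
      rw [if_neg hzs]
      lia

lemma Insep.mono (h : Insep G k K X) (hX : X ⊆ Y) : Insep G k K Y :=
  ⟨h.1.trans hX, fun S hS a ha b hb =>
    (h.2 S hS a ha b hb).mono (Finset.sdiff_subset_sdiff hX Finset.Subset.rfl)⟩

lemma Insep.le_card_bdry (h : Insep G k K X) (ha : a ∈ K) (haE : a ∈ E) (hb : b ∈ K) (hbE : b ∉ E)
    (hb' : b ∉ bdry G X E) : k ≤ (bdry G X E).card := by
  by_contra! hlt
  have hab := h.2 _ hlt a (Finset.mem_sdiff.mpr ⟨ha, fun h => (mem_bdry.mp h).1.2 haE⟩) b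
    (Finset.mem_sdiff.mpr ⟨hb, hb'⟩)
  refine hbE ?_
  clear hb hbE hb'
  induction hab with
  | refl => exact haE
  | @tail x y _ hxy ih =>
    obtain ⟨hyX, hy⟩ := Finset.mem_sdiff.mp hxy.2.1
    by_contra hyE
    exact hy (mem_bdry.mpr ⟨⟨hyX, hyE⟩, x, ih, hxy.2.2⟩)

lemma Insep.sdiff_of_card_bdry_le_one (h : Insep G k K X) (hKE : Disjoint K E)
    (hE : (bdry G X E).card ≤ 1) : Insep G k K (X \ E) := by
  refine ⟨Finset.subset_sdiff.mpr ⟨h.1, hKE⟩, fun S hS a ha b hb => ?_⟩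
  rw [Finset.disjoint_left] at hKE
  have hcard : (bdry G (X \ S) E).card ≤ 1 :=
    (Finset.card_le_card fun x hx => by grind [mem_bdry]).trans hE
  have := (h.2 S hS a ha b hb).sdiff_of_card_bdry_le_one (by grind) (by grind) hcard
  rwa [sdiff_right_comm] at this

lemma Insep.sdiff_of_card_bdry_le_two (h : Insep G (k + 1) K X) (hK : k + 1 < K.card)
    (hKE : Disjoint K E) (hE : (bdry G X E).card ≤ 2) : Insep G k K (X \ E) := by
  by_cases hE_one : (bdry G X E).card ≤ 1
  · have h' := h.sdiff_of_card_bdry_le_one hKE hE_one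
    exact ⟨h'.1, fun S hS => h'.2 S (by lia)⟩
  refine ⟨Finset.subset_sdiff.mpr ⟨h.1, hKE⟩, fun S hS => ?_⟩
  have havoid : ∀ s ∈ bdry G X E, ∀ a ∈ K \ S, ∀ b ∈ K \ S, a ≠ s → b ≠ s →
      ReachableIn G ((X \ E) \ S) a b := by
    intro s hs a ha b hb has hbs
    rw [Finset.disjoint_left] at hKE
    have hcard : (bdry G (X \ insert s S) E).card ≤ 1 := by
      have : bdry G (X \ insert s S) E ⊆ (bdry G X E).erase s := fun x hx => by grind [mem_bdry]
      grind [Finset.card_le_card this, Finset.card_erase_of_mem hs]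
    have hS' : (insert s S).card < k + 1 := (Finset.card_insert_le _ _).trans_lt (by lia)
    exact ((h.2 _ hS' a (by grind) b (by grind)).sdiff_of_card_bdry_le_one (by grind) (by grind)
      hcard).mono (by grind)
  intro a ha b hb
  by_cases hs : ∃ s ∈ bdry G X E, a ≠ s ∧ b ≠ s
  · obtain ⟨s, hs, has, hbs⟩ := hs
    exact havoid s hs a ha b hb has hbs
  · have hbdry : bdry G X E = {a, b} := Finset.eq_of_subset_of_card_le (by grind)
      (Finset.card_le_two.trans (by lia))
    obtain rfl | hab := eq_or_ne a b
    · exact .refl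
    obtain ⟨c, hcK, hc⟩ : ∃ c ∈ K, c ∉ {a, b} ∪ S := by
      refine Finset.exists_mem_notMem_of_card_lt_card ((Finset.card_union_le _ _).trans_lt ?_)
      have : ({a, b} : Finset V).card ≤ 2 := Finset.card_le_two
      lia
    have hac := havoid b (by simp [hbdry]) a ha c (by grind) hab (by grind)
    exact hac.trans (havoid a (by simp [hbdry]) c (by grind) b hb (by grind) hab.symm)

lemma Insep.replace (h : Insep G (k + 1) K X) (hK : k + 1 < K.card) (hKE : Disjoint K E)
    (hE : (bdry G X E).card ≤ 2) (hQ : ConnOn G Q) (hQX : Q ∩ X ⊆ E)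
    (hQE : 1 < (bdry G X E).card → ∀ s ∈ bdry G X E, ∃ q ∈ Q, G.Adj q s) :
    Insep G (k + 1) K ((X \ E) ∪ Q) := by
  by_cases hE_one : (bdry G X E).card ≤ 1
  · exact (h.sdiff_of_card_bdry_le_one hKE hE_one).mono Finset.subset_union_left
  have hKE' := Finset.disjoint_left.mp hKE
  refine ⟨(Finset.subset_sdiff.mpr ⟨h.1, hKE⟩).trans Finset.subset_union_left,
    fun S hS a ha b hb => ?_⟩
  by_cases hQS : Disjoint Q S
  · have hQ' : ∀ q ∈ Q, q ∈ ((X \ E) ∪ Q) \ S := by grind [Finset.disjoint_left]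
    refine (h.2 S hS a ha b hb).reroute (E := E) (by grind) (by grind) (by grind)
      fun s hs s' hs' => ?_
    obtain ⟨⟨hsX, hsE⟩, hsadj⟩ := mem_bdry.mp hs
    obtain ⟨⟨hsX', hsE'⟩, hsadj'⟩ := mem_bdry.mp hs'
    obtain ⟨q, hq, hqs⟩ := hQE (by lia) s (mem_bdry.mpr ⟨⟨by grind, hsE⟩, hsadj⟩)
    obtain ⟨q', hq', hqs'⟩ := hQE (by lia) s' (mem_bdry.mpr ⟨⟨by grind, hsE'⟩, hsadj'⟩)
    exact (reachableIn_of_adj (by grind) (hQ' q hq) hqs.symm).trans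
      (((hQ q hq q' hq').mono fun x hx => hQ' x hx).trans
        (reachableIn_of_adj (hQ' q' hq') (by grind) hqs'))
  · obtain ⟨q, hqQ, hqS⟩ := Finset.not_disjoint_iff.mp hQS
    have hcard : (S \ Q).card < k := by
      have := Finset.card_lt_card (Finset.ssubset_iff_of_subset Finset.sdiff_subset |>.mpr
        ⟨q, hqS, fun h => (Finset.mem_sdiff.mp h).2 hqQ⟩)
      lia
    exact ((h.sdiff_of_card_bdry_le_two hK hKE hE).2 (S \ Q) hcard a (by grind) b (by grind)).mono
      (by grind)

lemma IsFanCenter.mono (h : IsFanCenter G k Y N a) (hY : Y ⊆ Y') : IsFanCenter G k Y' N a :=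
  fun S hS haS => (h S hS haS).imp fun _ ⟨hn, han⟩ =>
    ⟨hn, han.mono (Finset.sdiff_subset_sdiff hY Finset.Subset.rfl)⟩

lemma IsFanCenter.insert_erase (h : IsFanCenter G k Y (insert x (N.erase y)) a) (hax : a ≠ x)
    (hx : x ∈ Y) (hyY : y ∉ Y) (hyN : y ∈ N) (hxy : G.Adj x y) :
    IsFanCenter G k (insert y Y) N a := by
  intro S hS haS
  by_cases hyS : y ∈ S
  · obtain ⟨n, hn, han⟩ := h (insert x (S.erase y))
      ((Finset.card_insert_le _ _).trans_lt (by rwa [Finset.card_erase_add_one hyS])) (by grind)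
    exact ⟨n, by grind, han.mono (by grind)⟩
  · obtain ⟨n, hn, han⟩ := h S hS haS
    have han' : ReachableIn G (insert y Y \ S) a n := han.mono (by grind)
    by_cases hnx : n = x
    · subst hnx
      exact ⟨y, by grind, han'.trans (reachableIn_of_adj (by grind) (by grind) hxy)⟩
    · exact ⟨n, by grind, han'⟩

lemma ConnOn.isFanCenter_of_adj_of_adj (hD : ConnOn G D) (hDN : Disjoint D N) (hN : N.card = 3)
    (hadj : ∀ n ∈ N, ∃ d ∈ D, G.Adj d n) (hx : x ∈ D) (ha : a ∈ N) (hb : b ∈ N) (hab : a ≠ b)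
    (hxa : G.Adj x a) (hxb : G.Adj x b) : IsFanCenter G 3 (D ∪ N) N x := by
  intro S hS hxS
  by_cases haS : a ∈ S; swap
  · exact ⟨a, by grind, reachableIn_of_adj (by grind) (by grind) hxa⟩
  by_cases hbS : b ∈ S; swap
  · exact ⟨b, by grind, reachableIn_of_adj (by grind) (by grind) hxb⟩
  have hS_eq : {a, b} = S :=
    Finset.eq_of_subset_of_card_le (by grind) (by rw [Finset.card_pair hab]; lia)
  have hDS : D ⊆ (D ∪ N) \ S := by grind [Finset.disjoint_left]
  obtain ⟨n, hn, hnS⟩ := Finset.exists_mem_notMem_of_card_lt_card (hN ▸ hS)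
  obtain ⟨d, hd, hdn⟩ := hadj n hn
  exact ⟨n, by grind,
    ((hD x hx d hd).mono hDS).trans (reachableIn_of_adj (hDS hd) (by grind) hdn)⟩

lemma ConnOn.exists_isFanCenter (hD : ConnOn G D) (hDN : Disjoint D N) (hN : N.card = 3)
    (hadj : ∀ n ∈ N, ∃ d ∈ D, G.Adj d n) : ∃ t ∈ D, IsFanCenter G 3 (D ∪ N) N t := by
  induction hcard : D.card using Nat.strong_induction_on generalizing D N with
  | _ _ ih =>
  have hDN' := Finset.disjoint_left.mp hDN
  obtain ⟨r, hr⟩ : D.Nonempty := by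
    obtain ⟨n, hn⟩ := Finset.card_pos.mp (show 0 < N.card by lia)
    exact (hadj n hn).imp fun d hd => hd.1
  by_cases hDr : D = {r}
  · obtain ⟨n, hn, n', hn', hnn'⟩ := Finset.one_lt_card.mp (show 1 < N.card by lia)
    subst hDr
    exact ⟨r, hr, hD.isFanCenter_of_adj_of_adj hDN hN hadj hr hn hn' hnn'
      (by simpa using hadj n hn) (by simpa using hadj n' hn')⟩
  obtain ⟨x, hx, hxr, hDx⟩ := hD.exists_erase hr hDr
  have hlt := hcard ▸ Finset.card_erase_lt_of_mem hx
  have hxadj : ∀ n ∈ N, (∀ d ∈ D.erase x, ¬ G.Adj d n) → G.Adj x n := by grind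
  by_cases hall : ∀ n ∈ N, ∃ d ∈ D.erase x, G.Adj d n
  · obtain ⟨t, ht, hfan⟩ := ih _ hlt hDx (hDN.mono_left (Finset.erase_subset _ _)) hN hall rfl
    exact ⟨t, Finset.mem_of_mem_erase ht, hfan.mono (by grind)⟩
  push Not at hall
  obtain ⟨n, hn, hnx⟩ := hall
  by_cases hrest : ∀ l ∈ N.erase n, ∃ d ∈ D.erase x, G.Adj d l
  · have hxN : x ∉ N.erase n := fun h => hDN' hx (Finset.mem_of_mem_erase h)
    obtain ⟨_, hl, y, hy, hyx, hxy⟩ :=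
      hD.exists_adj (Finset.singleton_subset_iff.mpr hx) ⟨x, by simp⟩ (by grind)
    rw [Finset.mem_singleton.mp hl] at hxy
    obtain ⟨t, ht, hfan⟩ := ih _ hlt hDx (N := insert x (N.erase n))
      (by grind [Finset.disjoint_left])
      (by rw [Finset.card_insert_of_notMem hxN, Finset.card_erase_add_one hn, hN])
      (by
        rw [Finset.forall_mem_insert]
        exact ⟨⟨y, by grind, hxy.symm⟩, hrest⟩) rfl
    refine ⟨t, Finset.mem_of_mem_erase ht, (hfan.insert_erase (Finset.ne_of_mem_erase ht) (by simp)
      ?_ hn (hxadj n hn hnx)).mono (by grind)⟩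
    grind
  · push Not at hrest
    obtain ⟨l, hl, hlx⟩ := hrest
    obtain ⟨hln, hlN⟩ := Finset.mem_erase.mp hl
    exact ⟨x, hx, hD.isFanCenter_of_adj_of_adj hDN hN hadj hx hn hlN hln.symm (hxadj n hn hnx)
      (hxadj l hlN hlx)⟩

lemma Insep.insert_of_isFanCenter (h : Insep G k K X) (ha : a ∈ X) (hfan : IsFanCenter G k X K a) :
    Insep G k (insert a K) X := by
  refine ⟨Finset.insert_subset ha h.1, fun S hS => ?_⟩
  have hreach : ∀ c ∈ insert a K \ S, ∃ n ∈ K \ S, ReachableIn G (X \ S) c n := by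
    intro c hc
    obtain ⟨hc, hcS⟩ := Finset.mem_sdiff.mp hc
    rcases Finset.mem_insert.mp hc with rfl | hc
    · exact hfan S hS hcS
    · exact ⟨c, Finset.mem_sdiff.mpr ⟨hc, hcS⟩, .refl⟩
  intro b hb c hc
  obtain ⟨n, hn, hbn⟩ := hreach b hb
  obtain ⟨n', hn', hcn'⟩ := hreach c hc
  exact hbn.trans ((h.2 S hS n hn n' hn').trans hcn'.symm)

lemma Insep.exists_insert (h : Insep G 3 K X) (hDX : D ⊆ X) (hD : ConnOn G D)
    (hDK : Disjoint D K) (hcard : 3 ≤ (attached G.Adj D K).card) :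
    ∃ t ∈ D, Insep G 3 (insert t K) X := by
  obtain ⟨N, hNsub, hN⟩ := Finset.exists_subset_card_eq hcard
  have hNK : N ⊆ K := hNsub.trans (Finset.filter_subset _ _)
  obtain ⟨t, ht, hfan⟩ := hD.exists_isFanCenter (hDK.mono_right hNK) hN fun n hn =>
    (mem_attached.mp (hNsub hn)).2
  refine ⟨t, ht, h.insert_of_isFanCenter (hDX ht) fun S hS htS => ?_⟩
  obtain ⟨n, hn, htn⟩ := (hfan.mono (Finset.union_subset hDX (hNK.trans h.1))) S hS htS
  exact ⟨n, Finset.sdiff_subset_sdiff hNK Finset.Subset.rfl hn, htn⟩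

end Reachability

/-! ### Inseparable sets in graphs of minimum degree three -/

section DenseSubgraph

variable {X Y D D₀ S A B : Finset V} {a b s : V}

lemma exists_separation (ha : a ∈ X \ S) (hb : b ∈ X \ S) (hab : ¬ ReachableIn G (X \ S) a b) :
    ∃ A B, a ∈ A ∧ b ∈ B ∧ Disjoint A B ∧ A ∪ B = X \ S ∧ bdry G X A ⊆ S ∧ bdry G X B ⊆ S := by
  refine ⟨component G (X \ S) a, (X \ S) \ component G (X \ S) a, mem_component_self ha,
    Finset.mem_sdiff.mpr ⟨hb, fun h => hab (Finset.mem_filter.mp h).2⟩, Finset.disjoint_sdiff,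
    Finset.union_sdiff_of_subset component_subset, bdry_component_subset, fun y hy => ?_⟩
  obtain ⟨⟨hyX, hy⟩, x, hx, hxy⟩ := mem_bdry.mp hy
  by_contra hyS
  obtain ⟨hxS, hx⟩ := Finset.mem_sdiff.mp hx
  have hyS := Finset.mem_sdiff.mpr ⟨hyX, hyS⟩
  have hy : y ∈ component G (X \ S) a := by grind
  exact hx (Finset.mem_filter.mpr ⟨hxS,
    (Finset.mem_filter.mp hy).2.trans (reachableIn_of_adj hyS hxS hxy.symm)⟩)

lemma card_eq_card_inter_add (hAB : Disjoint A B) (hAB_eq : A ∪ B = X \ S) (hY : Y ⊆ X) :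
    Y.card = (Y ∩ A).card + (Y ∩ B).card + (Y ∩ S).card := by
  have hmem := fun y => Finset.ext_iff.mp hAB_eq y
  simp only [Finset.mem_union, Finset.mem_sdiff] at hmem
  rw [Finset.disjoint_left] at hAB
  rw [← Finset.card_union_of_disjoint (by grind [Finset.disjoint_left]),
    ← Finset.card_union_of_disjoint (by grind [Finset.disjoint_left])]
  congr 1
  grind

variable (G) in
/-- A pair as in Mader's argument: `D₀` is a smallest nonempty set with at most one boundary vertex
in `X`, and `D` is a smallest nonempty subset of `D₀` with at most two. -/
structure IsTightPair (X D₀ D : Finset V) : Prop where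
  outer_subset : D₀ ⊆ X
  subset_outer : D ⊆ D₀
  nonempty : D.Nonempty
  card_bdry_outer : (bdry G X D₀).card ≤ 1
  card_bdry : (bdry G X D).card ≤ 2
  two_le_of_lt : ∀ E ⊆ X, E.Nonempty → E.card < D₀.card → 2 ≤ (bdry G X E).card
  three_le_of_lt : ∀ E ⊆ D₀, E.Nonempty → E.card < D.card → 3 ≤ (bdry G X E).card

lemma exists_isTightPair (hX : X.Nonempty) : ∃ D₀ D, IsTightPair G X D₀ D := by
  have hbdryX : bdry G X X = ∅ := by grind [mem_bdry]
  obtain ⟨D₀, ⟨hD₀X, hD₀, hD₀_bdry⟩, hD₀_min⟩ := Set.exists_min_image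
    {D | D ⊆ X ∧ D.Nonempty ∧ (bdry G X D).card ≤ 1} Finset.card
    (X.powerset.finite_toSet.subset fun D hD => Finset.mem_powerset.mpr hD.1)
    ⟨X, Finset.Subset.rfl, hX, by simp [hbdryX]⟩
  obtain ⟨D, ⟨hDD₀, hD, hD_bdry⟩, hD_min⟩ := Set.exists_min_image
    {D | D ⊆ D₀ ∧ D.Nonempty ∧ (bdry G X D).card ≤ 2} Finset.card
    (D₀.powerset.finite_toSet.subset fun D hD => Finset.mem_powerset.mpr hD.1)
    ⟨D₀, Finset.Subset.rfl, hD₀, by lia⟩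
  refine ⟨D₀, D, hD₀X, hDD₀, hD, hD₀_bdry, hD_bdry, fun E hEX hE hlt => ?_,
    fun E hED₀ hE hlt => ?_⟩
  · by_contra hcon
    exact hlt.not_ge (hD₀_min E ⟨hEX, hE, by lia⟩)
  · by_contra hcon
    exact hlt.not_ge (hD_min E ⟨hED₀, hE, by lia⟩)

lemma disjoint_bdry : Disjoint D (bdry G X D) :=
  Finset.disjoint_left.mpr fun _ hd hd' => (mem_bdry.mp hd').1.2 hd

lemma bdry_subset : bdry G X D ⊆ X := fun _ hx => (mem_bdry.mp hx).1.1

lemma degIn_lt_card_add_card_bdry (ha : a ∈ D) : degIn G X a < D.card + (bdry G X D).card := by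
  rw [← Finset.card_union_of_disjoint disjoint_bdry]
  refine Finset.card_lt_card ((Finset.ssubset_iff_of_subset fun x hx => ?_).mpr
    ⟨a, Finset.mem_union_left _ ha, by simp⟩)
  grind [mem_bdry]

namespace IsTightPair

lemma subset (h : IsTightPair G X D₀ D) : D ⊆ X := h.subset_outer.trans h.outer_subset

lemma card_bdry_inter (h : IsTightPair G X D₀ D) (hA : bdry G X A ⊆ S) (hDA : (D ∩ A).Nonempty)
    (hb : b ∈ D ∪ bdry G X D) (hbA : b ∉ A) (hbS : b ∉ S) :
    3 ≤ (bdry G X D ∩ A).card + (bdry G X D ∩ S).card + (D ∩ S).card := by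
  have := h.subset
  have hlt : (D ∩ A).card < D.card := Finset.card_lt_card (Finset.ssubset_iff_subset_ne.mpr
    ⟨Finset.inter_subset_left, fun hDA_eq => by grind [mem_bdry]⟩)
  have hsub : bdry G X (D ∩ A) ⊆ (bdry G X D ∩ A ∪ bdry G X D ∩ S) ∪ D ∩ S := by
    intro y hy
    grind [mem_bdry]
  have := h.three_le_of_lt _ (Finset.inter_subset_left.trans h.subset_outer) hDA hlt
  have := Finset.card_le_card hsub
  have := Finset.card_union_le (bdry G X D ∩ A ∪ bdry G X D ∩ S) (D ∩ S)
  have := Finset.card_union_le (bdry G X D ∩ A) (bdry G X D ∩ S)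
  lia

lemma card_bdry_inter_add_card_inter (hS : S.card < 3) :
    (bdry G X D ∩ S).card + (D ∩ S).card < 3 := by
  rw [← Finset.card_union_of_disjoint (disjoint_bdry.symm.mono Finset.inter_subset_left
    Finset.inter_subset_left)]
  exact (Finset.card_le_card (by grind)).trans_lt hS

lemma one_le_card_bdry_inter (h : IsTightPair G X D₀ D) (hS : S.card < 3) (hA : bdry G X A ⊆ S)
    (ha : a ∈ D ∪ bdry G X D) (haA : a ∈ A) (hb : b ∈ D ∪ bdry G X D) (hbA : b ∉ A)
    (hbS : b ∉ S) : 1 ≤ (bdry G X D ∩ A).card := by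
  by_cases haD : a ∈ D
  · have := h.card_bdry_inter hA ⟨a, Finset.mem_inter.mpr ⟨haD, haA⟩⟩ hb hbA hbS
    have := card_bdry_inter_add_card_inter (G := G) (X := X) (D := D) hS
    lia
  · exact Finset.card_pos.mpr
      ⟨a, Finset.mem_inter.mpr ⟨(Finset.mem_union.mp ha).resolve_left haD, haA⟩⟩

/-- A side `A` of a separator inside `D` that contains just one boundary vertex `s` of `D` and none
of `D₀` would yield the smaller set `insert s (D ∩ A)`, whose boundary lies in the separator. -/
lemma bdry_inter_ne_singleton (h : IsTightPair G X D₀ D) (hS : S.card < 3) (hSD : S ⊆ D)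
    (hA : bdry G X A ⊆ S) (hcard : (D ∩ A).card + 2 ≤ D.card)
    (hA_outer : Disjoint A (bdry G X D₀)) : bdry G X D ∩ A ≠ {s} := by
  intro hs
  have hDD₀ := h.subset_outer
  have hD₀X := h.outer_subset
  rw [Finset.disjoint_left] at hA_outer
  have hsD : s ∈ bdry G X D ∩ A := hs ▸ Finset.mem_singleton_self s
  have hs_unique : ∀ y ∈ bdry G X D, y ∈ A → y = s := fun y hy hyA =>
    Finset.mem_singleton.mp (hs ▸ Finset.mem_inter.mpr ⟨hy, hyA⟩)
  have hsD₀ : s ∈ D₀ := by grind [mem_bdry]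
  have houter : A ∩ D₀ ⊆ insert s D := by
    by_contra hcon
    obtain ⟨e, he, hes⟩ := Finset.not_subset.mp hcon
    have hsub : (A ∩ D₀) \ insert s D ⊆ D₀.erase s := by grind
    have hbdry : bdry G X ((A ∩ D₀) \ insert s D) ⊆ {s} := by
      intro y hy
      grind [mem_bdry, G.adj_comm]
    have := h.two_le_of_lt ((A ∩ D₀) \ insert s D) (by grind) ⟨e, by grind⟩
      ((Finset.card_le_card hsub).trans_lt (Finset.card_erase_lt_of_mem hsD₀))
    have := Finset.card_le_card hbdry
    rw [Finset.card_singleton] at this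
    lia
  have hbdry : bdry G X (insert s (D ∩ A)) ⊆ S := by
    intro y hy
    obtain ⟨⟨hyX, hy_notMem⟩, w, hw, hwy⟩ := mem_bdry.mp hy
    have hw_mem : w ∈ A ∧ w ∈ D₀ := by grind
    by_contra hyS
    have hyA : y ∈ A := by
      by_contra hyA
      exact hyS (hA (mem_bdry.mpr ⟨⟨hyX, hyA⟩, w, hw_mem.1, hwy⟩))
    have hyD₀ : y ∈ D₀ := by
      by_contra hyD₀
      exact hA_outer hyA (mem_bdry.mpr ⟨⟨hyX, hyD₀⟩, w, hw_mem.2, hwy⟩)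
    have := houter (Finset.mem_inter.mpr ⟨hyA, hyD₀⟩)
    grind
  have := h.three_le_of_lt (insert s (D ∩ A)) (by grind) (Finset.insert_nonempty _ _)
    (by have := Finset.card_insert_le s (D ∩ A); lia)
  have := Finset.card_le_card hbdry
  lia

lemma insep (h : IsTightPair G X D₀ D) (hcard : 4 ≤ D.card + (bdry G X D).card) :
    Insep G 3 (D ∪ bdry G X D) X := by
  have hKX : D ∪ bdry G X D ⊆ X := Finset.union_subset h.subset bdry_subset
  refine ⟨hKX, fun S hS a ha b hb => ?_⟩
  obtain ⟨ha, haS⟩ := Finset.mem_sdiff.mp ha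
  obtain ⟨hb, hbS⟩ := Finset.mem_sdiff.mp hb
  by_contra hab
  obtain ⟨A, B, haA, hbB, hAB, hAB_eq, hA, hB⟩ := exists_separation
    (Finset.mem_sdiff.mpr ⟨hKX ha, haS⟩) (Finset.mem_sdiff.mpr ⟨hKX hb, hbS⟩) hab
  have hD_card := card_eq_card_inter_add hAB hAB_eq h.subset
  have hbdry_card := card_eq_card_inter_add hAB hAB_eq (bdry_subset (G := G) (D := D))
  have hbA := Finset.disjoint_right.mp hAB hbB
  have haB := Finset.disjoint_left.mp hAB haA
  have hbdryA := h.one_le_card_bdry_inter hS hA ha haA hb hbA hbS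
  have hbdryB := h.one_le_card_bdry_inter hS hB hb hbB ha haB haS
  have hbdry_two := h.card_bdry
  have hS_inter := card_bdry_inter_add_card_inter (G := G) (X := X) (D := D) hS
  have hDS : 2 ≤ (D ∩ S).card := by
    rcases (D ∩ A).eq_empty_or_nonempty with hDA | hDA
    · rcases (D ∩ B).eq_empty_or_nonempty with hDB | hDB
      · rw [hDA, hDB, Finset.card_empty] at hD_card
        lia
      · have := h.card_bdry_inter hB hDB ha haB haS
        lia
    · have := h.card_bdry_inter hA hDA hb hbA hbS
      lia
  have hSD : S ⊆ D := Finset.inter_eq_right.mp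
    (Finset.eq_of_subset_of_card_le Finset.inter_subset_right (by lia))
  obtain ⟨s, hs⟩ := Finset.card_eq_one.mp (show (bdry G X D ∩ A).card = 1 by lia)
  obtain ⟨s', hs'⟩ := Finset.card_eq_one.mp (show (bdry G X D ∩ B).card = 1 by lia)
  by_cases hA_outer : Disjoint A (bdry G X D₀)
  · exact h.bdry_inter_ne_singleton hS hSD hA (by lia) hA_outer hs
  · obtain ⟨y, hyA, hy⟩ := Finset.not_disjoint_iff.mp hA_outer
    refine h.bdry_inter_ne_singleton hS hSD hB (by lia)
      (Finset.disjoint_right.mpr fun z hz => ?_) hs'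
    rw [Finset.card_le_one.mp h.card_bdry_outer z hz y hy]
    exact Finset.disjoint_left.mp hAB hyA

end IsTightPair

lemma exists_insep_of_three_le_degIn (hX : X.Nonempty) (hdeg : ∀ x ∈ X, 3 ≤ degIn G X x) :
    ∃ K, 4 ≤ K.card ∧ Insep G 3 K X := by
  obtain ⟨D₀, D, h⟩ := exists_isTightPair (G := G) hX
  obtain ⟨a, ha⟩ := h.nonempty
  have hcard : 4 ≤ D.card + (bdry G X D).card :=
    (hdeg a (h.subset ha)).trans_lt (degIn_lt_card_add_card_bdry ha)
  exact ⟨_, hcard.trans_eq (Finset.card_union_of_disjoint disjoint_bdry).symm, h.insep hcard⟩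

end DenseSubgraph

/-! ### Largest inseparable sets -/

section Trim

variable {K X E : Finset V} {a z : V} {k : ℕ}

lemma Insep.exists_connOn_card_bdry_lt (h : Insep G k K X) (ha : a ∈ X)
    (hins : ¬ Insep G k (insert a K) X) :
    ∃ E ⊆ X, a ∈ E ∧ Disjoint K E ∧ ConnOn G E ∧ (bdry G X E).card < k := by
  obtain ⟨S, hS, haS, hsep⟩ : ∃ S : Finset V, S.card < k ∧ a ∉ S ∧
      ∀ b ∈ K \ S, ¬ ReachableIn G (X \ S) a b := by
    by_contra! hcon
    exact hins (h.insert_of_isFanCenter ha hcon)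
  refine ⟨component G (X \ S) a, component_subset.trans Finset.sdiff_subset,
    mem_component_self (Finset.mem_sdiff.mpr ⟨ha, haS⟩),
    Finset.disjoint_left.mpr fun b hb hbE => ?_, connOn_component,
    (Finset.card_le_card bdry_component_subset).trans_lt hS⟩
  obtain ⟨hbS, hab⟩ := Finset.mem_filter.mp hbE
  exact hsep b (Finset.mem_sdiff.mpr ⟨hb, (Finset.mem_sdiff.mp hbS).2⟩) hab

lemma Insep.exists_trim (h : Insep G (k + 1) K X) (hK : k + 1 < K.card) (hEX : E ⊆ X)
    (hKE : Disjoint K E) (hE : ConnOn G E) (hbdry : (bdry G X E).card ≤ 2) (hz : z ∈ E) :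
    ∃ F ⊆ E, Insep G (k + 1) K (X \ F) ∧ degIn G X z ≤ F.card + 2 := by
  obtain ⟨P, hPE, -, hP, hPbdry, hdeg⟩ := hE.exists_fan hz G.Adj (bdry G X E)
    fun s hs => (mem_bdry.mp hs).2
  refine ⟨E \ P, Finset.sdiff_subset, ?_, ?_⟩
  · rw [show X \ (E \ P) = X \ E ∪ P by grind]
    exact h.replace hK hKE hbdry hP (Finset.inter_subset_left.trans hPE) fun _ => hPbdry
  · have hsub : X.filter (G.Adj z) ⊆
        (E \ P) ∪ (P.filter (G.Adj z) ∪ (bdry G X E).filter (G.Adj z)) := by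
      intro y hy
      grind [mem_bdry]
    have := Finset.card_le_card hsub
    have := Finset.card_union_le (E \ P) (P.filter (G.Adj z) ∪ (bdry G X E).filter (G.Adj z))
    have := Finset.card_union_le (P.filter (G.Adj z)) ((bdry G X E).filter (G.Adj z))
    unfold degIn at *
    lia

end Trim

section Extremal

variable {T : ParentTree W} {K X X' D E : Finset V} {a z : V}

lemma ParentTree.HasCopy.card_le [Fintype W] (h : T.HasCopy G X) : Fintype.card W ≤ X.card := by
  obtain ⟨φ, hφ⟩ := h
  rw [← Finset.card_univ, ← Finset.card_image_of_injective _ hφ.inj]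
  exact Finset.card_le_card fun x hx => by
    obtain ⟨w, -, rfl⟩ := Finset.mem_image.mp hx
    exact hφ.mem w

variable [Fintype V]

variable (T G) in
/-- `K` has at least four elements and is a largest set that is inseparable in the complement of a
set containing a copy of `T`. -/
structure IsMaxInsep (K : Finset V) : Prop where
  four_le : 4 ≤ K.card
  card_le : ∀ K' X', Insep G 3 K' X' → T.HasCopy G X'ᶜ → K'.card ≤ K.card

lemma IsMaxInsep.not_insep_insert (hK : IsMaxInsep G T K) (ha : a ∉ K) (hT : T.HasCopy G Xᶜ) :
    ¬ Insep G 3 (insert a K) X := fun h => by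
  have := hK.card_le _ _ h hT
  rw [Finset.card_insert_of_notMem ha] at this
  lia

lemma IsMaxInsep.card_attached_le_two (hK : IsMaxInsep G T K) (h : Insep G 3 K X)
    (hT : T.HasCopy G Xᶜ) (hDX : D ⊆ X) (hKD : Disjoint K D) (hD : ConnOn G D) :
    (attached G.Adj D K).card ≤ 2 := by
  by_contra hcon
  obtain ⟨t, ht, hins⟩ := h.exists_insert hDX hD hKD.symm (by lia)
  exact hK.not_insep_insert (Finset.disjoint_right.mp hKD ht) hT hins

variable (T G) in
/-- `(K, X, D)` consists of a largest inseparable set `K`, a set `X` in which it is inseparable, and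
a connected subset `D` of `X \ K`, chosen such that first `D` is as large and then `X` as small as
possible. -/
structure IsExtremal (K X D : Finset V) : Prop where
  isMaxInsep : IsMaxInsep G T K
  insep : Insep G 3 K X
  hasCopy : T.HasCopy G Xᶜ
  subset : D ⊆ X
  disjoint : Disjoint K D
  connOn : ConnOn G D
  card_le_of_connOn : ∀ X' D', Insep G 3 K X' → T.HasCopy G X'ᶜ → D' ⊆ X' → Disjoint K D' →
    ConnOn G D' → D'.card ≤ D.card
  card_le_of_subset : ∀ X', Insep G 3 K X' → T.HasCopy G X'ᶜ → D ⊆ X' → X.card ≤ X'.card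

lemma exists_isExtremal (h : ∃ K X, 4 ≤ K.card ∧ Insep G 3 K X ∧ T.HasCopy G Xᶜ) :
    ∃ K X D, IsExtremal G T K X D := by
  obtain ⟨K₀, X₀, hK₀, hinsep₀, hT₀⟩ := h
  obtain ⟨⟨K, X₁⟩, ⟨hinsep₁, hT₁⟩, hK_max⟩ := Set.exists_max_image
    {p : Finset V × Finset V | Insep G 3 p.1 p.2 ∧ T.HasCopy G p.2ᶜ} (·.1.card) (Set.toFinite _)
    ⟨(K₀, X₀), hinsep₀, hT₀⟩
  obtain ⟨⟨X₂, D⟩, ⟨hinsep₂, hT₂, hDX₂, hKD, hD⟩, hD_max⟩ := Set.exists_max_image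
    {p : Finset V × Finset V | Insep G 3 K p.1 ∧ T.HasCopy G p.1ᶜ ∧ p.2 ⊆ p.1 ∧ Disjoint K p.2 ∧
      ConnOn G p.2} (·.2.card) (Set.toFinite _)
    ⟨(X₁, ∅), hinsep₁, hT₁, Finset.empty_subset _, Finset.disjoint_empty_right _, by simp [ConnOn]⟩
  obtain ⟨X, ⟨hinsep, hT, hDX⟩, hX_min⟩ := Set.exists_min_image
    {X | Insep G 3 K X ∧ T.HasCopy G Xᶜ ∧ D ⊆ X} Finset.card (Set.toFinite _)
    ⟨X₂, hinsep₂, hT₂, hDX₂⟩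
  exact ⟨K, X, D, ⟨hK₀.trans (hK_max (K₀, X₀) ⟨hinsep₀, hT₀⟩),
    fun K' X' hK' hT' => hK_max (K', X') ⟨hK', hT'⟩⟩, hinsep, hT, hDX, hKD, hD,
    fun X' D' hK' hT' hD'X' hKD' hD' => hD_max (X', D') ⟨hK', hT', hD'X', hKD', hD'⟩,
    fun X' hK' hT' hDX' => hX_min X' ⟨hK', hT', hDX'⟩⟩

namespace IsExtremal

lemma subset_of_mem_or_adj (h : IsExtremal G T K X D) (hX' : Insep G 3 K X')
    (hT : T.HasCopy G X'ᶜ) (hDX' : D ⊆ X') (hEX' : E ⊆ X') (hKE : Disjoint K E) (hE : ConnOn G E)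
    (hED : ∃ e ∈ E, e ∈ D ∨ ∃ d ∈ D, G.Adj d e) : E ⊆ D := by
  have hconn : ConnOn G (D ∪ E) := by
    obtain ⟨e, he, heD | ⟨d, hd, hde⟩⟩ := hED
    · exact h.connOn.union hE heD he
    · exact h.connOn.union_of_adj hE hd he hde
  have hcard := h.card_le_of_connOn X' (D ∪ E) hX' hT (Finset.union_subset hDX' hEX')
    (Finset.disjoint_union_right.mpr ⟨h.disjoint, hKE⟩) hconn
  exact Finset.union_eq_left.mp (Finset.eq_of_subset_of_card_le Finset.subset_union_left hcard).symm

lemma degIn_add_card_le (h : IsExtremal G T K X D) (hX' : Insep G 3 K X') (hT : T.HasCopy G X'ᶜ)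
    (hDX' : D ⊆ X') (hEX' : E ⊆ X') (hKE : Disjoint K E) (hE : ConnOn G E)
    (hbdry : (bdry G X' E).card ≤ 2) (hz : z ∈ E) (hzD : z ∉ D) :
    degIn G X' z + X.card ≤ X'.card + 2 := by
  have hDE : Disjoint D E := Finset.disjoint_right.mpr fun e he heD =>
    hzD (h.subset_of_mem_or_adj hX' hT hDX' hEX' hKE hE ⟨e, he, Or.inl heD⟩ hz)
  obtain ⟨F, hFE, hF, hdeg⟩ := hX'.exists_trim h.isMaxInsep.four_le hEX' hKE hE hbdry hz
  have hcard := h.card_le_of_subset _ hF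
    (hT.mono (Finset.compl_subset_compl.mpr Finset.sdiff_subset))
    (Finset.subset_sdiff.mpr ⟨hDX', hDE.mono_right hFE⟩)
  have := Finset.card_sdiff_add_card_eq_card (hFE.trans hEX')
  lia

lemma degIn_le_three_of_hasCopy_erase (h : IsExtremal G T K X D) (ha : a ∈ Xᶜ)
    (hT : T.HasCopy G (Xᶜ.erase a)) : (∀ d ∈ D, ¬ G.Adj d a) ∧ degIn G X a ≤ 3 := by
  rw [Finset.mem_compl] at ha
  rw [← Finset.compl_insert] at hT
  have hX : X ⊆ insert a X := Finset.subset_insert _ _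
  have haD : a ∉ D := fun haD => ha (h.subset haD)
  have hinsep := h.insep.mono hX
  obtain ⟨E, hEX, haE, hKE, hE, hbdry⟩ := hinsep.exists_connOn_card_bdry_lt
    (Finset.mem_insert_self a X)
    (h.isMaxInsep.not_insep_insert (fun haK => ha (h.insep.1 haK)) hT)
  refine ⟨fun d hd hda => haD (h.subset_of_mem_or_adj hinsep hT (h.subset.trans hX) hEX hKE hE
    ⟨a, haE, Or.inr ⟨d, hd, hda⟩⟩ haE), ?_⟩
  have := h.degIn_add_card_le hinsep hT (h.subset.trans hX) hEX hKE hE (by lia) haE haD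
  rw [Finset.card_insert_of_notMem ha] at this
  have := degIn_mono (G := G) hX a
  lia

lemma exists_adj_compl (h : IsExtremal G T K X D) (hD : D.Nonempty)
    (hG : Insep G 3 Finset.univ Finset.univ) : ∃ a ∈ Xᶜ, ∃ d ∈ D, G.Adj d a := by
  by_contra! hcon
  have hcard := h.isMaxInsep.card_attached_le_two h.insep h.hasCopy h.subset h.disjoint h.connOn
  have hfour := h.isMaxInsep.four_le
  obtain ⟨k, hk, hkU⟩ := Finset.exists_mem_notMem_of_card_lt_card
    (show (attached G.Adj D K).card < K.card by lia)
  have hbdry : bdry G Finset.univ D ⊆ attached G.Adj D K := by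
    intro y hy
    obtain ⟨⟨-, hyD⟩, d, hd, hdy⟩ := mem_bdry.mp hy
    refine mem_attached.mpr ⟨by_contra fun hyK => hyD ?_, d, hd, hdy⟩
    have hyX : y ∈ X := by_contra fun hyX => hcon y (Finset.mem_compl.mpr hyX) d hd hdy
    exact h.subset_of_mem_or_adj h.insep h.hasCopy h.subset (Finset.singleton_subset_iff.mpr hyX)
      (Finset.disjoint_singleton_right.mpr hyK) (connOn_singleton y)
      ⟨y, Finset.mem_singleton_self y, Or.inr ⟨d, hd, hdy⟩⟩ (Finset.mem_singleton_self y)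
  obtain ⟨d, hd⟩ := hD
  have := hG.le_card_bdry (Finset.mem_univ d) hd (Finset.mem_univ k)
    (Finset.disjoint_left.mp h.disjoint hk) fun hk => hkU (hbdry hk)
  have := Finset.card_le_card hbdry
  lia

lemma card_compl_eq [Fintype W] (h : IsExtremal G T K X D) (hD : D.Nonempty)
    (hG : Insep G 3 Finset.univ Finset.univ)
    (hdeg : ∀ v, Fintype.card W + 3 ≤ degIn G Finset.univ v) : Xᶜ.card = Fintype.card W := by
  refine (h.hasCopy.card_le.eq_or_lt.resolve_right fun hlt => ?_).symm
  obtain ⟨a, haX, hda⟩ := h.exists_adj_compl hD hG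
  obtain ⟨b, hb, hT⟩ := ParentTree.exists_hasCopy_erase
    (A := Xᶜ.filter fun z => (∃ d ∈ D, G.Adj d z) ∨ 4 ≤ degIn G X z)
    ⟨a, Finset.mem_filter.mpr ⟨haX, Or.inl hda⟩⟩ h.hasCopy hlt fun z hz hzA => by
      have hz_deg : ¬ 4 ≤ degIn G X z := fun h => hzA (Finset.mem_filter.mpr ⟨hz, Or.inr h⟩)
      have := degIn_add_degIn_compl (G := G) X z
      have := hdeg z
      lia
  obtain ⟨hbX, hb⟩ := Finset.mem_filter.mp hb
  obtain ⟨hDb, hb_deg⟩ := h.degIn_le_three_of_hasCopy_erase hbX hT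
  rcases hb with ⟨d, hd, hdb⟩ | hb
  · exact hDb d hd hdb
  · lia

lemma eq_union [Fintype W] (h : IsExtremal G T K X D) (hG : Insep G 3 Finset.univ Finset.univ)
    (hdeg : ∀ v, Fintype.card W + 3 ≤ degIn G Finset.univ v) : X = K ∪ D := by
  refine Finset.Subset.antisymm (fun x hx => ?_) (Finset.union_subset h.insep.1 h.subset)
  by_contra hxKD
  obtain ⟨hxK, hxD⟩ := not_or.mp (Finset.mem_union.not.mp hxKD)
  rcases D.eq_empty_or_nonempty with rfl | hD
  · have := h.card_le_of_connOn X {x} h.insep h.hasCopy (by simpa) (by simpa) (connOn_singleton x)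
    simp at this
  have hEX : component G (X \ K) x ⊆ X := component_subset.trans Finset.sdiff_subset
  have hKE : Disjoint K (component G (X \ K) x) :=
    Finset.disjoint_sdiff.mono_right component_subset
  have hbdry : bdry G X (component G (X \ K) x) ⊆ attached G.Adj (component G (X \ K) x) K :=
    fun y hy => mem_attached.mpr ⟨bdry_component_subset hy, (mem_bdry.mp hy).2⟩
  have := h.degIn_add_card_le h.insep h.hasCopy h.subset hEX hKE connOn_component
    ((Finset.card_le_card hbdry).trans (h.isMaxInsep.card_attached_le_two h.insep h.hasCopy hEX hKE
      connOn_component)) (mem_component_self (Finset.mem_sdiff.mpr ⟨hx, hxK⟩)) hxD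
  have := degIn_add_degIn_compl (G := G) X x
  have := hdeg x
  have := degIn_le_card (G := G) Xᶜ x
  have := h.card_compl_eq hD hG hdeg
  lia

end IsExtremal

end Extremal

/-! ### Links -/

section Link

variable {T : ParentTree W} {K U Q R D X : Finset V} {k q z : V}

lemma ConnOn.exists_fan_card_le (hR : ConnOn G R) (hz : z ∈ R) (r : V → V → Prop) (S : Finset V)
    (hS : ∀ s ∈ S, ∃ x ∈ R, r x s) :
    ∃ P ⊆ R, z ∈ P ∧ ConnOn G P ∧ (∀ s ∈ S, ∃ p ∈ P, r p s) ∧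
      degIn G R z + (S.filter (r z)).card + P.card ≤ R.card + S.card := by
  obtain ⟨P, hPR, hzP, hP, hPS, hdeg⟩ := hR.exists_fan hz r S hS
  refine ⟨P, hPR, hzP, hP, hPS, ?_⟩
  have := degIn_le_add_card_sdiff (G := G) R P z
  have := Finset.card_sdiff_add_card_eq_card hPR
  lia

lemma bdry_union_eq_attached (hKD : Disjoint K D) : bdry G (K ∪ D) D = attached G.Adj D K := by
  rw [bdry, Finset.union_sdiff_cancel_right hKD]

variable (G) in
/-- A connected set outside `K` attached to all vertices of `U`. -/
structure IsLink (K U Q : Finset V) : Prop where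
  disjoint : Disjoint K Q
  connOn : ConnOn G Q
  exists_adj : ∀ u ∈ U, ∃ q ∈ Q, G.Adj q u

lemma isLink_empty : IsLink G K ∅ ∅ :=
  ⟨Finset.disjoint_empty_right _, by simp [ConnOn], by simp⟩

variable (G) in
/-- `r` is adjacent to `k`, or `k` lies in `U` and can be reached from `r` through the link `Q`. -/
def LinkAdj (U Q : Finset V) (r k : V) : Prop := G.Adj r k ∨ k ∈ U ∧ ∃ q ∈ Q, G.Adj r q

lemma degIn_union_le_card_linkAdj (h : ∀ q ∈ Q, ¬ G.Adj z q) :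
    degIn G (K ∪ Q) z ≤ (K.filter (LinkAdj G U Q z)).card := by
  refine Finset.card_le_card fun y hy => ?_
  grind [LinkAdj]

variable [Fintype V]

variable (G T) in
/-- `K` is a largest inseparable set and it becomes inseparable in `K ∪ Q` for every link `Q`. The
case `U = ∅` occurs when `K` is inseparable in itself, so that no link is needed. -/
structure IsLinkable (K U : Finset V) : Prop where
  isMaxInsep : IsMaxInsep G T K
  subset : U ⊆ K
  card : U = ∅ ∨ U.card = 2
  insep : ∀ Q, IsLink G K U Q → Insep G 3 K (K ∪ Q)

variable (G T) in
/-- A smallest link `Q` such that a copy of `T` remains outside `K ∪ Q`. -/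
structure IsMinLink (K U Q : Finset V) : Prop where
  isLinkable : IsLinkable G T K U
  isLink : IsLink G K U Q
  hasCopy : T.HasCopy G (K ∪ Q)ᶜ
  card_le : ∀ Q', IsLink G K U Q' → T.HasCopy G (K ∪ Q')ᶜ → Q.card ≤ Q'.card

lemma IsMaxInsep.isLinkable_attached (hK : IsMaxInsep G T K) (h : Insep G 3 K (K ∪ D))
    (hT : T.HasCopy G (K ∪ D)ᶜ) (hKD : Disjoint K D) (hD : ConnOn G D) (hKK : ¬ Insep G 3 K K) :
    IsLinkable G T K (attached G.Adj D K) := by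
  have hbdry := bdry_union_eq_attached (G := G) hKD
  have htwo := hK.card_attached_le_two h hT Finset.subset_union_right hKD hD
  have hsdiff : (K ∪ D) \ D = K := Finset.union_sdiff_cancel_right hKD
  refine ⟨hK, Finset.filter_subset _ _, Or.inr (htwo.antisymm ?_), fun Q hQ => ?_⟩
  · by_contra hlt
    have := h.sdiff_of_card_bdry_le_one hKD (by rw [hbdry]; lia)
    exact hKK (by rwa [hsdiff] at this)
  · have hQD : Q ∩ (K ∪ D) ⊆ D := by grind [Finset.disjoint_left.mp hQ.disjoint]
    have := h.replace hK.four_le hKD (hbdry ▸ htwo) hQ.connOn hQD fun _ => hbdry ▸ hQ.exists_adj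
    rwa [hsdiff] at this

lemma IsMaxInsep.exists_isMinLink (hK : IsMaxInsep G T K) (h : Insep G 3 K (K ∪ D))
    (hT : T.HasCopy G (K ∪ D)ᶜ) (hKD : Disjoint K D) (hD : ConnOn G D) :
    ∃ U Q, IsMinLink G T K U Q := by
  obtain ⟨U, hU, Q₀, hQ₀, hT₀⟩ : ∃ U, IsLinkable G T K U ∧
      ∃ Q, IsLink G K U Q ∧ T.HasCopy G (K ∪ Q)ᶜ := by
    by_cases hKK : Insep G 3 K K
    · exact ⟨∅, ⟨hK, Finset.empty_subset _, Or.inl rfl,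
        fun Q _ => hKK.mono Finset.subset_union_left⟩, ∅, isLink_empty, hT.mono
          (Finset.compl_subset_compl.mpr (by simp))⟩
    · exact ⟨_, hK.isLinkable_attached h hT hKD hD hKK, D,
        ⟨hKD, hD, fun u hu => (mem_attached.mp hu).2⟩, hT⟩
  obtain ⟨Q, ⟨hQ, hQT⟩, hQ_min⟩ := Set.exists_min_image
    {Q | IsLink G K U Q ∧ T.HasCopy G (K ∪ Q)ᶜ} Finset.card (Set.toFinite _) ⟨Q₀, hQ₀, hT₀⟩
  exact ⟨U, Q, hU, hQ, hQT, fun Q' hQ' hT' => hQ_min Q' ⟨hQ', hT'⟩⟩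

lemma IsLinkable.card_le_two (h : IsLinkable G T K U) : U.card ≤ 2 := by
  rcases h.card with rfl | h
  · simp
  · exact h.le

namespace IsMinLink

lemma card_attached_le_two (h : IsMinLink G T K U Q) (hQX : K ∪ Q ⊆ X) (hT : T.HasCopy G Xᶜ)
    (hDX : D ⊆ X) (hKD : Disjoint K D) (hD : ConnOn G D) : (attached G.Adj D K).card ≤ 2 :=
  h.isLinkable.isMaxInsep.card_attached_le_two ((h.isLinkable.insep Q h.isLink).mono hQX) hT hDX
    hKD hD

lemma card_eq_two (h : IsMinLink G T K U Q) (hQ : Q.Nonempty) : U.card = 2 := by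
  refine h.isLinkable.card.resolve_left fun hU => ?_
  have hcard := h.card_le ∅ (by rw [hU]; exact isLink_empty)
    (h.hasCopy.mono (Finset.compl_subset_compl.mpr (by simp)))
  exact hQ.ne_empty (Finset.card_eq_zero.mp (Nat.le_zero.mp hcard))

lemma attached_subset (h : IsMinLink G T K U Q) (hQ : Q.Nonempty) (hQD : Q ⊆ D)
    (hT : T.HasCopy G (K ∪ D)ᶜ) (hKD : Disjoint K D) (hD : ConnOn G D) :
    attached G.Adj D K ⊆ U := by
  have hU : U ⊆ attached G.Adj D K := fun u hu =>
    have ⟨q, hq, hqu⟩ := h.isLink.exists_adj u hu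
    mem_attached.mpr ⟨h.isLinkable.subset hu, q, hQD hq, hqu⟩
  refine (Finset.eq_of_subset_of_card_le hU ?_).superset
  rw [h.card_eq_two hQ]
  exact h.card_attached_le_two (Finset.union_subset_union_right hQD) hT Finset.subset_union_right
    hKD hD

lemma exists_isLink_subset (h : IsMinLink G T K U Q) (hQ : Q.Nonempty) (hQD : Q ⊆ D)
    (hT : T.HasCopy G (K ∪ D)ᶜ) (hKD : Disjoint K D) (hD : ConnOn G D) (hz : z ∈ D) :
    ∃ P ⊆ D, z ∈ P ∧ IsLink G K U P ∧ T.HasCopy G (K ∪ P)ᶜ ∧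
      degIn G (K ∪ D) z + P.card ≤ D.card + 2 := by
  have hattached := h.attached_subset hQ hQD hT hKD hD
  obtain ⟨P, hPD, hzP, hP, hPU, hcard⟩ := hD.exists_fan_card_le hz G.Adj U fun u hu =>
    (h.isLink.exists_adj u hu).imp fun q hq => ⟨hQD hq.1, hq.2⟩
  refine ⟨P, hPD, hzP, ⟨hKD.mono_right hPD, hP, hPU⟩,
    hT.mono (Finset.compl_subset_compl.mpr (Finset.union_subset_union_right hPD)), ?_⟩
  have hsub : (K ∪ D).filter (G.Adj z) ⊆ D.filter (G.Adj z) ∪ U.filter (G.Adj z) := by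
    intro y hy
    grind [mem_attached]
  have := Finset.card_le_card hsub
  have := Finset.card_union_le (D.filter (G.Adj z)) (U.filter (G.Adj z))
  have := h.card_eq_two hQ
  unfold degIn at *
  lia

lemma eq_empty [Fintype W] (h : IsMinLink G T K U Q) (hcard : (K ∪ Q)ᶜ.card = Fintype.card W)
    (hdeg : ∀ v, Fintype.card W + 3 ≤ degIn G Finset.univ v) : Q = ∅ := by
  by_contra hQ
  obtain ⟨z, hz⟩ := Finset.nonempty_iff_ne_empty.mpr hQ
  obtain ⟨P, -, -, hP, hT, hP_card⟩ := h.exists_isLink_subset ⟨z, hz⟩ Finset.Subset.rfl h.hasCopy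
    h.isLink.disjoint h.isLink.connOn hz
  have := h.card_le P hP hT
  have := degIn_add_degIn_compl (G := G) (K ∪ Q) z
  have := degIn_le_card (G := G) (K ∪ Q)ᶜ z
  have := hdeg z
  lia

lemma exists_isLink_insert (h : IsMinLink G T K U Q) (hz : z ∈ (K ∪ Q)ᶜ)
    (hT : T.HasCopy G ((K ∪ Q)ᶜ.erase z)) (hq : q ∈ Q) (hqz : G.Adj q z) :
    (∀ k ∈ K, G.Adj z k → k ∈ U) ∧ ∃ P ⊆ insert z Q, z ∈ P ∧ IsLink G K U P ∧
      T.HasCopy G (K ∪ P)ᶜ ∧ degIn G (K ∪ Q) z + P.card ≤ Q.card + 3 := by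
  have hzK : z ∉ K := fun hzK => Finset.mem_compl.mp hz (Finset.mem_union_left Q hzK)
  rw [← Finset.compl_insert, ← Finset.union_insert] at hT
  have hKz : Disjoint K (insert z Q) := Finset.disjoint_insert_right.mpr ⟨hzK, h.isLink.disjoint⟩
  have hconn := h.isLink.connOn.insert_of_adj hq hqz
  have hQz := Finset.subset_insert z Q
  refine ⟨fun k hk hzk => h.attached_subset ⟨q, hq⟩ hQz hT hKz hconn
    (mem_attached.mpr ⟨hk, z, Finset.mem_insert_self z Q, hzk⟩), ?_⟩
  obtain ⟨P, hPQ, hzP, hP, hPT, hcard⟩ := h.exists_isLink_subset ⟨q, hq⟩ hQz hT hKz hconn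
    (Finset.mem_insert_self z Q)
  refine ⟨P, hPQ, hzP, hP, hPT, ?_⟩
  have := degIn_mono (G := G) (Finset.union_subset_union_right (s := K) hQz) z
  have := Finset.card_insert_le z Q
  lia

lemma card_le_of_hasCopy_erase (h : IsMinLink G T K U Q) (hz : z ∈ (K ∪ Q)ᶜ)
    (hT : T.HasCopy G ((K ∪ Q)ᶜ.erase z)) :
    (K.filter (LinkAdj G U Q z)).card ≤ 2 ∧ degIn G (K ∪ Q) z ≤ 3 := by
  by_cases hzQ : ∃ q ∈ Q, G.Adj z q
  · obtain ⟨q, hq, hzq⟩ := hzQ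
    obtain ⟨hzU, P, -, -, hP, hPT, hcard⟩ := h.exists_isLink_insert hz hT hq hzq.symm
    have hsub : K.filter (LinkAdj G U Q z) ⊆ U := by
      intro k hk
      grind [LinkAdj]
    have := h.card_le P hP hPT
    exact ⟨(Finset.card_le_card hsub).trans h.isLinkable.card_le_two, by lia⟩
  · push Not at hzQ
    rw [← Finset.compl_insert] at hT
    have hzK : z ∉ K := fun hzK => Finset.mem_compl.mp hz (Finset.mem_union_left Q hzK)
    have hsub : K.filter (LinkAdj G U Q z) ⊆ attached G.Adj {z} K := fun k hk =>
      have ⟨hkK, hzk⟩ := Finset.mem_filter.mp hk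
      mem_attached.mpr ⟨hkK, z, Finset.mem_singleton_self z,
        hzk.resolve_right fun ⟨_, q, hq, hzq⟩ => hzQ q hq hzq⟩
    have htwo := (Finset.card_le_card hsub).trans (h.card_attached_le_two
      (Finset.subset_insert z (K ∪ Q)) hT (by simp) (Finset.disjoint_singleton_right.mpr hzK)
      (connOn_singleton z))
    exact ⟨htwo, (degIn_union_le_card_linkAdj hzQ).trans (htwo.trans (Nat.le_succ 2))⟩

lemma card_le_of_lt [Fintype W] (h : IsMinLink G T K U Q)
    (hdeg : ∀ v, Fintype.card W + 3 ≤ degIn G Finset.univ v)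
    (hlt : Fintype.card W < (K ∪ Q)ᶜ.card) (hz : z ∈ (K ∪ Q)ᶜ) :
    (K.filter (LinkAdj G U Q z)).card ≤ 2 ∧ degIn G (K ∪ Q) z ≤ 3 := by
  by_contra hcon
  obtain ⟨a, ha, hT⟩ := ParentTree.exists_hasCopy_erase
    (A := (K ∪ Q)ᶜ.filter fun z =>
      ¬ ((K.filter (LinkAdj G U Q z)).card ≤ 2 ∧ degIn G (K ∪ Q) z ≤ 3))
    ⟨z, Finset.mem_filter.mpr ⟨hz, hcon⟩⟩ h.hasCopy hlt fun x hx hxA => by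
      have hx_deg : (K.filter (LinkAdj G U Q x)).card ≤ 2 ∧ degIn G (K ∪ Q) x ≤ 3 := by
        by_contra hx_deg
        exact hxA (Finset.mem_filter.mpr ⟨hx, hx_deg⟩)
      have := degIn_add_degIn_compl (G := G) (K ∪ Q) x
      have := hdeg x
      lia
  obtain ⟨haZ, ha⟩ := Finset.mem_filter.mp ha
  exact ha (h.card_le_of_hasCopy_erase haZ hT)

lemma filter_linkAdj_eq (h : IsMinLink G T K U Q) (hq : q ∈ Q) (hzq : G.Adj z q)
    (hz : (K.filter (LinkAdj G U Q z)).card ≤ 2) : K.filter (LinkAdj G U Q z) = U := by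
  refine (Finset.eq_of_subset_of_card_le (fun u hu => ?_) ?_).symm
  · exact Finset.mem_filter.mpr ⟨h.isLinkable.subset hu, Or.inr ⟨hu, q, hq, hzq⟩⟩
  · rwa [h.card_eq_two ⟨q, hq⟩]

end IsMinLink

end Link

/-! ### Nonlocal sets -/

section Nonlocal

variable {T : ParentTree W} {K U Q Q' R R' : Finset V} {p q r w x z : V}

lemma attached_mono {s : V → V → Prop} (h : R ⊆ R') : attached s R K ⊆ attached s R' K :=
  Finset.monotone_filter_right _ fun _ _ ⟨d, hd, hdk⟩ => ⟨d, h hd, hdk⟩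

lemma ConnOn.exists_ssubset_mem (hR : ConnOn G R) (hzR : z ∉ R) (hz : 2 ≤ degIn G R z)
    (hr : r ∈ R) : ∃ P ⊂ R, r ∈ P ∧ ConnOn G P ∧ ∃ p ∈ P, G.Adj z p := by
  obtain ⟨y, hy⟩ := Finset.card_pos.mp (show 0 < degIn G R z by lia)
  obtain ⟨hyR, hzy⟩ := Finset.mem_filter.mp hy
  have hrz : r ≠ z := fun h => hzR (h ▸ hr)
  obtain ⟨P, hPR, hzP, hrP, hP, hdeg⟩ := ((hR.insert_of_adj hyR hzy.symm) z
    (Finset.mem_insert_self z R) r (Finset.mem_insert_of_mem hr)).exists_connOn_degIn_le_one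
    (Finset.mem_insert_self z R)
  obtain ⟨l, hl, p, hp, hpz, hlp⟩ := hP.exists_adj (Finset.singleton_subset_iff.mpr hzP)
    (Finset.singleton_nonempty z) (fun h => hrz (Finset.mem_singleton.mp (h ▸ hrP)))
  rw [Finset.mem_singleton] at hl hpz
  refine ⟨P.erase z, ⟨Finset.subset_insert_iff.mp hPR, fun hRP => ?_⟩,
    Finset.mem_erase.mpr ⟨hrz, hrP⟩, hP.erase_of_degIn_le_one hdeg, p,
    Finset.mem_erase.mpr ⟨hpz, hp⟩, hl ▸ hlp⟩
  have := degIn_mono (G := G) (hRP.trans (Finset.erase_subset z P)) z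
  lia

lemma three_le_card_attached_linkAdj (hUK : U ⊆ K) (hU : U.card = 2) (hw : w ∈ K) (hwU : w ∉ U)
    (hr : r ∈ R) (hrw : G.Adj r w) (hp : p ∈ R) (hq : q ∈ Q) (hpq : G.Adj p q) :
    3 ≤ (attached (LinkAdj G U Q) R K).card := by
  have hcard : (insert w U).card = 3 := by rw [Finset.card_insert_of_notMem hwU, hU]
  rw [← hcard]
  refine Finset.card_le_card (Finset.insert_subset (mem_attached.mpr ⟨hw, r, hr, Or.inl hrw⟩) ?_)
  exact fun u hu => mem_attached.mpr ⟨hUK hu, p, hp, Or.inr ⟨hu, q, hq, hpq⟩⟩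

variable (G) in
/-- A connected set outside `K ∪ Q` that is attached to at least three vertices of `K`, either
directly or through the link `Q`. -/
structure IsNonlocal (K U Q R : Finset V) : Prop where
  connOn : ConnOn G R
  disjoint : Disjoint (K ∪ Q) R
  three_le : 3 ≤ (attached (LinkAdj G U Q) R K).card

namespace IsNonlocal

lemma insert (h : IsNonlocal G K U Q R) (hz : z ∉ K ∪ Q) (hr : r ∈ R) (hrz : G.Adj r z) :
    IsNonlocal G K U Q (insert z R) :=
  ⟨h.connOn.insert_of_adj hr hrz, Finset.disjoint_insert_right.mpr ⟨hz, h.disjoint⟩,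
    h.three_le.trans (Finset.card_le_card (attached_mono (Finset.subset_insert z R)))⟩

lemma exists_adj_notMem (h : IsNonlocal G K U Q R) (hU : U.card ≤ 2) :
    ∃ r ∈ R, ∃ w ∈ K, w ∉ U ∧ G.Adj r w := by
  obtain ⟨w, hw, hwU⟩ := Finset.exists_mem_notMem_of_card_lt_card
    (show U.card < (attached (LinkAdj G U Q) R K).card from hU.trans_lt h.three_le)
  obtain ⟨hwK, r, hr, hrw⟩ := mem_attached.mp hw
  exact ⟨r, hr, w, hwK, hwU, hrw.resolve_right fun h => hwU h.1⟩

lemma exists_subset (h : IsNonlocal G K U Q R) (hz : z ∈ R)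
    (hz_two : (K.filter (LinkAdj G U Q z)).card ≤ 2) :
    ∃ P ⊆ R, IsNonlocal G K U Q P ∧
      degIn G R z + (K.filter (LinkAdj G U Q z)).card + P.card ≤ R.card + 3 := by
  obtain ⟨S, hzS, hSR, hS⟩ := Finset.exists_subsuperset_card_eq (n := 3)
    (show K.filter (LinkAdj G U Q z) ⊆ attached (LinkAdj G U Q) R K from
      Finset.monotone_filter_right _ fun _ _ hzk => ⟨z, hz, hzk⟩) (by lia) h.three_le
  obtain ⟨P, hPR, -, hP, hPS, hcard⟩ := h.connOn.exists_fan_card_le hz (LinkAdj G U Q) S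
    fun s hs => (mem_attached.mp (hSR hs)).2
  refine ⟨P, hPR, ⟨hP, h.disjoint.mono_right hPR, hS ▸ Finset.card_le_card fun s hs =>
    mem_attached.mpr ⟨(mem_attached.mp (hSR hs)).1, hPS s hs⟩⟩, ?_⟩
  have := Finset.card_le_card fun k hk =>
    Finset.mem_filter.mpr ⟨hzS hk, (Finset.mem_filter.mp hk).2⟩
  lia

end IsNonlocal

variable [Fintype V]

namespace IsMinLink

lemma exists_adj_notMem (h : IsMinLink G T K U Q) (hG : Insep G 3 Finset.univ Finset.univ)
    (hz : z ∉ K ∪ Q) : ∃ x ∉ K ∪ Q, ∃ k ∈ K, k ∉ U ∧ G.Adj x k := by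
  by_contra! hcon
  have htwo := h.isLinkable.card_le_two
  have hfour := h.isLinkable.isMaxInsep.four_le
  obtain ⟨k, hk, hkU⟩ := Finset.exists_mem_notMem_of_card_lt_card (show U.card < K.card by lia)
  have hbdry : bdry G Finset.univ Kᶜ ⊆ U := by
    intro b hb
    obtain ⟨⟨-, hbK⟩, a, ha, hab⟩ := mem_bdry.mp hb
    rw [Finset.notMem_compl] at hbK
    by_contra hbU
    by_cases haQ : a ∈ Q
    · exact hbU (h.attached_subset ⟨a, haQ⟩ Finset.Subset.rfl h.hasCopy h.isLink.disjoint
        h.isLink.connOn (mem_attached.mpr ⟨hbK, a, haQ, hab⟩))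
    · exact hcon a (Finset.notMem_union.mpr ⟨Finset.mem_compl.mp ha, haQ⟩) b hbK hbU hab
  have := hG.le_card_bdry (Finset.mem_univ z)
    (Finset.mem_compl.mpr (Finset.notMem_union.mp hz).1) (Finset.mem_univ k)
    (Finset.notMem_compl.mpr hk) fun hk => hkU (hbdry hk)
  have := Finset.card_le_card hbdry
  lia

lemma exists_isNonlocal (h : IsMinLink G T K U Q) (hG : Insep G 3 Finset.univ Finset.univ)
    (hz : z ∉ K ∪ Q) : ∃ R, IsNonlocal G K U Q R := by
  obtain ⟨x, hx, w, hw, hwU, hxw⟩ := h.exists_adj_notMem hG hz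
  set R := component G (Finset.univ \ (K ∪ Q)) x
  have hxR : x ∈ R := mem_component_self (by simpa using hx)
  have hdisj : Disjoint (K ∪ Q) R := Finset.disjoint_sdiff.mono_right component_subset
  refine ⟨R, connOn_component, hdisj, ?_⟩
  by_cases hRQ : ∃ p ∈ R, ∃ q ∈ Q, G.Adj p q
  · obtain ⟨p, hp, q, hq, hpq⟩ := hRQ
    exact three_le_card_attached_linkAdj h.isLinkable.subset (h.card_eq_two ⟨q, hq⟩) hw hwU hxR hxw
      hp hq hpq
  push Not at hRQ
  by_contra! hlt
  have hfour := h.isLinkable.isMaxInsep.four_le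
  obtain ⟨k, hk, hkR⟩ := Finset.exists_mem_notMem_of_card_lt_card
    (show (attached (LinkAdj G U Q) R K).card < K.card by lia)
  have hbdry : bdry G Finset.univ R ⊆ attached (LinkAdj G U Q) R K := by
    intro y hy
    obtain ⟨-, p, hp, hpy⟩ := mem_bdry.mp hy
    have hyK := (Finset.mem_union.mp (bdry_component_subset hy)).resolve_right
      fun hyQ => hRQ p hp y hyQ hpy
    exact mem_attached.mpr ⟨hyK, p, hp, Or.inl hpy⟩
  have := hG.le_card_bdry (Finset.mem_univ x) hxR (Finset.mem_univ k)
    (Finset.disjoint_left.mp hdisj (Finset.mem_union_left Q hk)) fun hk => hkR (hbdry hk)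
  have := Finset.card_le_card hbdry
  lia

lemma exists_isNonlocal_card_lt (h : IsMinLink G T K U Q) (hR : IsNonlocal G K U Q R)
    (hz : z ∉ K ∪ Q) (hzR : z ∉ R) (hT : T.HasCopy G ((K ∪ Q)ᶜ.erase z)) (hq : q ∈ Q)
    (hqz : G.Adj q z) (hz_three : 3 ≤ degIn G (K ∪ Q) z) (hzR_two : 2 ≤ degIn G R z) :
    ∃ Q' R', IsMinLink G T K U Q' ∧ IsNonlocal G K U Q' R' ∧ R'.card < R.card := by
  obtain ⟨-, Q', hQ', hzQ', hlink, hT', hcard⟩ :=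
    h.exists_isLink_insert (Finset.mem_compl.mpr hz) hT hq hqz
  have hU := h.card_eq_two ⟨q, hq⟩
  obtain ⟨r, hr, w, hw, hwU, hrw⟩ := hR.exists_adj_notMem hU.le
  obtain ⟨R', hR', hrR', hconn, p, hp, hzp⟩ := hR.connOn.exists_ssubset_mem hzR hzR_two hr
  have hmin : IsMinLink G T K U Q' := ⟨h.isLinkable, hlink, hT', fun Q₁ hQ₁ hT₁ =>
    le_trans (by lia) (h.card_le Q₁ hQ₁ hT₁)⟩
  have hdisj : Disjoint (K ∪ Q') R' := by
    refine Disjoint.mono (Finset.union_subset_union_right hQ') hR'.subset ?_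
    rw [Finset.union_insert]
    exact Finset.disjoint_insert_left.mpr ⟨hzR, hR.disjoint⟩
  exact ⟨Q', R', hmin, ⟨hconn, hdisj, three_le_card_attached_linkAdj h.isLinkable.subset hU hw hwU
    hrR' hrw hp hzQ' hzp.symm⟩, Finset.card_lt_card hR'⟩

lemma card_compl_eq (h : IsMinLink G T K U Q) (h' : IsMinLink G T K U Q') :
    (K ∪ Q)ᶜ.card = (K ∪ Q')ᶜ.card := by
  rw [Finset.card_compl, Finset.card_compl, Finset.card_union_of_disjoint h.isLink.disjoint,
    Finset.card_union_of_disjoint h'.isLink.disjoint,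
    (h.card_le Q' h'.isLink h'.hasCopy).antisymm (h'.card_le Q h.isLink h.hasCopy)]

lemma hasCopy_erase [Fintype W] (h : IsMinLink G T K U Q)
    (hdeg : ∀ v, Fintype.card W + 3 ≤ degIn G Finset.univ v)
    (hlt : Fintype.card W < (K ∪ Q)ᶜ.card) (z : V) : T.HasCopy G ((K ∪ Q)ᶜ.erase z) := by
  have hW : 0 < Fintype.card W := Fintype.card_pos_iff.mpr ⟨T.root⟩
  have hcard := Finset.pred_card_le_card_erase (s := (K ∪ Q)ᶜ) (a := z)
  refine ParentTree.hasCopy_of_le_degIn (Finset.card_pos.mp (by lia)) fun x hx => ?_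
  have := (h.card_le_of_lt hdeg hlt (Finset.mem_of_mem_erase hx)).2
  have := degIn_add_degIn_compl (G := G) (K ∪ Q) x
  have := hdeg x
  have := degIn_le_add_card_sdiff (G := G) (K ∪ Q)ᶜ ((K ∪ Q)ᶜ.erase z) x
  have : ((K ∪ Q)ᶜ \ (K ∪ Q)ᶜ.erase z).card ≤ 1 :=
    Finset.card_le_one.mpr fun a ha b hb => by grind
  lia

lemma not_hasCopy_compl (h : IsMinLink G T K U Q) (hR : IsNonlocal G K U Q R) :
    ¬ T.HasCopy G (K ∪ Q ∪ R)ᶜ := by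
  intro hT
  have hKR : Disjoint K R := hR.disjoint.mono_left Finset.subset_union_left
  suffices ∃ D ⊆ Q ∪ R, Disjoint K D ∧ ConnOn G D ∧
      attached (LinkAdj G U Q) R K ⊆ attached G.Adj D K by
    obtain ⟨D, hD, hKD, hconn, hsub⟩ := this
    have := h.card_attached_le_two Finset.subset_union_left hT
      (hD.trans (Finset.union_subset_union_left Finset.subset_union_right)) hKD hconn
    have := Finset.card_le_card hsub
    have := hR.three_le
    lia
  by_cases hRQ : ∃ r ∈ R, ∃ q ∈ Q, G.Adj r q
  · obtain ⟨r, hr, q, hq, hrq⟩ := hRQ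
    refine ⟨Q ∪ R, Finset.Subset.rfl, Finset.disjoint_union_right.mpr ⟨h.isLink.disjoint, hKR⟩,
      h.isLink.connOn.union_of_adj hR.connOn hq hr hrq.symm, fun k hk => ?_⟩
    obtain ⟨hkK, x, hx, hxk | ⟨hkU, -⟩⟩ := mem_attached.mp hk
    · exact mem_attached.mpr ⟨hkK, x, Finset.mem_union_right Q hx, hxk⟩
    · obtain ⟨p, hp, hpk⟩ := h.isLink.exists_adj k hkU
      exact mem_attached.mpr ⟨hkK, p, Finset.mem_union_left R hp, hpk⟩
  · refine ⟨R, Finset.subset_union_right, hKR, hR.connOn, fun k hk => ?_⟩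
    obtain ⟨hkK, x, hx, hxk | ⟨-, q, hq, hxq⟩⟩ := mem_attached.mp hk
    · exact mem_attached.mpr ⟨hkK, x, hx, hxk⟩
    · exact absurd ⟨x, hx, q, hq, hxq⟩ hRQ

end IsMinLink

variable (G T) in
/-- `Q` is a smallest link, and `R` is a smallest nonlocal set over all choices of such a link. -/
structure IsMinNonlocal (K U Q R : Finset V) : Prop where
  isMinLink : IsMinLink G T K U Q
  isNonlocal : IsNonlocal G K U Q R
  card_le : ∀ Q' R', IsMinLink G T K U Q' → IsNonlocal G K U Q' R' → R.card ≤ R'.card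

lemma exists_isMinNonlocal (hQ : IsMinLink G T K U Q) (hR : IsNonlocal G K U Q R) :
    ∃ Q' R', IsMinNonlocal G T K U Q' R' := by
  obtain ⟨⟨Q', R'⟩, ⟨hQ', hR'⟩, hmin⟩ := Set.exists_min_image
    {p : Finset V × Finset V | IsMinLink G T K U p.1 ∧ IsNonlocal G K U p.1 p.2} (·.2.card)
    (Set.toFinite _) ⟨(Q, R), hQ, hR⟩
  exact ⟨Q', R', hQ', hR', fun Q₁ R₁ hQ₁ hR₁ => hmin (Q₁, R₁) ⟨hQ₁, hR₁⟩⟩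

namespace IsMinNonlocal

lemma degIn_add_card_le (h : IsMinNonlocal G T K U Q R) (hR' : IsNonlocal G K U Q R') (hz : z ∈ R')
    (hz_two : (K.filter (LinkAdj G U Q z)).card ≤ 2) :
    degIn G R' z + (K.filter (LinkAdj G U Q z)).card + R.card ≤ R'.card + 3 := by
  obtain ⟨P, -, hP, hcard⟩ := hR'.exists_subset hz hz_two
  have := h.card_le Q P h.isMinLink hP
  lia

variable [Fintype W]

lemma degIn_add_degIn_le_four (h : IsMinNonlocal G T K U Q R)
    (hdeg : ∀ v, Fintype.card W + 3 ≤ degIn G Finset.univ v)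
    (hlt : Fintype.card W < (K ∪ Q)ᶜ.card) (hz : z ∉ K ∪ Q) (hzR : z ∉ R) :
    degIn G (K ∪ Q) z + degIn G R z ≤ 4 := by
  by_contra! hcon
  obtain ⟨htwo, hthree⟩ := h.isMinLink.card_le_of_lt hdeg hlt (Finset.mem_compl.mpr hz)
  obtain ⟨y, hy⟩ := Finset.card_pos.mp (show 0 < degIn G R z by lia)
  obtain ⟨hyR, hzy⟩ := Finset.mem_filter.mp hy
  have hcard := h.degIn_add_card_le (h.isNonlocal.insert hz hyR hzy.symm)
    (Finset.mem_insert_self z R) htwo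
  rw [Finset.card_insert_of_notMem hzR] at hcard
  have hmono := degIn_mono (G := G) (Finset.subset_insert z R) z
  by_cases hzQ : ∃ q ∈ Q, G.Adj z q
  · obtain ⟨q, hq, hzq⟩ := hzQ
    have hU := h.isMinLink.card_eq_two ⟨q, hq⟩
    rw [h.isMinLink.filter_linkAdj_eq hq hzq htwo] at hcard
    obtain ⟨Q', R', hQ', hR', hlt'⟩ := h.isMinLink.exists_isNonlocal_card_lt h.isNonlocal hz hzR
      (h.isMinLink.hasCopy_erase hdeg hlt z) hq hzq.symm (by lia) (by lia)
    exact hlt'.not_ge (h.card_le Q' R' hQ' hR')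
  · push Not at hzQ
    have := degIn_union_le_card_linkAdj (K := K) (U := U) hzQ
    lia

lemma compl_nonempty (h : IsMinNonlocal G T K U Q R)
    (hdeg : ∀ v, Fintype.card W + 3 ≤ degIn G Finset.univ v)
    (hlt : Fintype.card W < (K ∪ Q)ᶜ.card) : (K ∪ Q ∪ R)ᶜ.Nonempty := by
  obtain ⟨r, hr, w, hw, hwU, hrw⟩ :=
    h.isNonlocal.exists_adj_notMem h.isMinLink.isLinkable.card_le_two
  have htwo := (h.isMinLink.card_le_of_lt hdeg hlt
    (Finset.mem_compl.mpr (Finset.disjoint_right.mp h.isNonlocal.disjoint hr))).1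
  have hrQ : ∀ q ∈ Q, ¬ G.Adj r q := fun q hq hrq => hwU
    (h.isMinLink.filter_linkAdj_eq hq hrq htwo ▸ Finset.mem_filter.mpr ⟨hw, Or.inl hrw⟩)
  have := h.degIn_add_card_le h.isNonlocal hr htwo
  have := degIn_union_le_card_linkAdj (K := K) (U := U) hrQ
  have := degIn_union_le (G := G) (K ∪ Q) R r
  have := degIn_add_degIn_compl (G := G) (K ∪ Q ∪ R) r
  have := hdeg r
  have := degIn_le_card (G := G) (K ∪ Q ∪ R)ᶜ r
  have hW : 0 < Fintype.card W := Fintype.card_pos_iff.mpr ⟨T.root⟩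
  exact Finset.card_pos.mp (by lia)

lemma hasCopy_compl (h : IsMinNonlocal G T K U Q R)
    (hdeg : ∀ v, Fintype.card W + 3 ≤ degIn G Finset.univ v)
    (hlt : Fintype.card W < (K ∪ Q)ᶜ.card) : T.HasCopy G (K ∪ Q ∪ R)ᶜ := by
  refine ParentTree.hasCopy_of_le_degIn (h.compl_nonempty hdeg hlt) fun z hz => ?_
  obtain ⟨hzKQ, hzR⟩ := Finset.notMem_union.mp (Finset.mem_compl.mp hz)
  have := h.degIn_add_degIn_le_four hdeg hlt hzKQ hzR
  have := degIn_union_le (G := G) (K ∪ Q) R z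
  have := degIn_add_degIn_compl (G := G) (K ∪ Q ∪ R) z
  have := hdeg z
  lia

end IsMinNonlocal

lemma IsMinLink.card_compl_eq_card [Fintype W] (h : IsMinLink G T K U Q)
    (hG : Insep G 3 Finset.univ Finset.univ)
    (hdeg : ∀ v, Fintype.card W + 3 ≤ degIn G Finset.univ v) :
    (K ∪ Q)ᶜ.card = Fintype.card W := by
  refine (h.hasCopy.card_le.eq_or_lt.resolve_right fun hlt => ?_).symm
  obtain ⟨z, hz⟩ := Finset.card_pos.mp (show 0 < (K ∪ Q)ᶜ.card by lia)
  obtain ⟨R, hR⟩ := h.exists_isNonlocal hG (Finset.mem_compl.mp hz)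
  obtain ⟨Q', R', hmin⟩ := exists_isMinNonlocal h hR
  rw [h.card_compl_eq hmin.isMinLink] at hlt
  exact hmin.isMinLink.not_hasCopy_compl hmin.isNonlocal (hmin.hasCopy_compl hdeg hlt)

end Nonlocal

/-! ### Back to `3`-connected graphs and trees -/

section Connectivity

variable {K Y : Finset V} {k : ℕ} {a b : V}

lemma reachableIn_of_reachable_induce {s : Set V} (hs : s ⊆ Y) {a b : s}
    (h : (G.induce s).Reachable a b) : ReachableIn G Y a b :=
  Relation.ReflTransGen.lift Subtype.val (fun x y hxy => ⟨hs x.2, hs y.2, hxy⟩) _ _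
    ((SimpleGraph.reachable_iff_reflTransGen a b).mp h)

lemma ReachableIn.reachable_induce (h : ReachableIn G Y a b) (ha : a ∈ Y) (hb : b ∈ Y) :
    (G.induce (Y : Set V)).Reachable ⟨a, ha⟩ ⟨b, hb⟩ := by
  induction h with
  | refl => exact .refl _
  | tail _ hxy ih => exact (ih hxy.1).trans (SimpleGraph.Adj.reachable hxy.2.2)

lemma insep_univ_of_isKConnected [Fintype V] (h : G.IsKConnected k) :
    Insep G k Finset.univ Finset.univ := by
  refine ⟨Finset.Subset.rfl, fun S hS a ha b hb => ?_⟩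
  exact reachableIn_of_reachable_induce (by simp [Set.compl_eq_univ_sdiff])
    ((h.2 S hS).preconnected ⟨a, by simpa using ha⟩ ⟨b, by simpa using hb⟩)

lemma Insep.isKConnected_induce (h : Insep G k K K) (hK : k < K.card) :
    (G.induce (K : Set V)).IsKConnected k := by
  refine ⟨by simpa using hK, fun S hS => ?_⟩
  let S' : Finset V := S.image Subtype.val
  have hS' : S'.card < k := Finset.card_image_le.trans_lt hS
  let f : G.induce ((K \ S' : Finset V) : Set V) →g
      (G.induce (K : Set V)).induce ((S : Set (K : Set V))ᶜ) :=
    { toFun v := ⟨⟨v, (Finset.mem_sdiff.mp v.2).1⟩,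
        fun hv => (Finset.mem_sdiff.mp v.2).2 (Finset.mem_image_of_mem Subtype.val hv)⟩
      map_rel' := id }
  have hmem : ∀ v : ((S : Set (K : Set V))ᶜ : Set _), (v : V) ∈ K \ S' := by
    rintro ⟨v, hv⟩
    simpa [S'] using hv
  obtain ⟨x, hxK, hxS⟩ := Finset.exists_mem_notMem_of_card_lt_card (hS'.trans hK)
  have : Nonempty ((S : Set (K : Set V))ᶜ : Set _) := ⟨f ⟨x, Finset.mem_sdiff.mpr ⟨hxK, hxS⟩⟩⟩
  exact ⟨fun a b => ((h.2 S' hS' a (hmem a) b (hmem b)).reachable_induce (hmem a) (hmem b)).map f⟩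

end Connectivity

lemma IsMinLink.insep_self [Fintype W] [Fintype V] {T : ParentTree W} {K U Q : Finset V}
    (h : IsMinLink G T K U Q) (hG : Insep G 3 Finset.univ Finset.univ)
    (hdeg : ∀ v, Fintype.card W + 3 ≤ degIn G Finset.univ v) :
    Insep G 3 K K ∧ T.HasCopy G Kᶜ ∧ Kᶜ.card = Fintype.card W := by
  have hcard := h.card_compl_eq_card hG hdeg
  have hKQ : K ∪ Q = K := by rw [h.eq_empty hcard hdeg, Finset.union_empty]
  have hins := h.isLinkable.insep Q h.isLink
  rw [hKQ] at hins hcard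
  exact ⟨hins, hKQ ▸ h.hasCopy, hcard⟩

namespace ParentTree

/-- Every edge of the graph `T₀` joins a vertex to its parent in `T`. -/
def IsRootingOf (T : ParentTree W) (T₀ : SimpleGraph W) : Prop :=
  ∀ a b, T₀.Adj a b → (a ≠ T.root ∧ T.parent a = b) ∨ (b ≠ T.root ∧ T.parent b = a)

lemma exists_isRootingOf {T₀ : SimpleGraph W} (h : T₀.IsTree) :
    ∃ T : ParentTree W, T.IsRootingOf T₀ := by
  obtain ⟨r⟩ := h.connected.nonempty
  choose p hp hp_unique using fun w => h.existsUnique_path w r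
  have hp_tail : ∀ w, p (p w).snd = (p w).tail := fun w =>
    (hp_unique _ _ (hp w).tail).symm
  have hnil : ∀ w, w ≠ r → ¬ (p w).Nil := fun w hw => SimpleGraph.Walk.not_nil_of_ne hw
  let T : ParentTree W :=
    { root := r
      parent w := (p w).snd
      depth w := (p w).length
      depth_parent_lt w hw := by
        rw [hp_tail, ← SimpleGraph.Walk.length_tail_add_one (hnil w hw)]
        exact Nat.lt_succ_self _ }
  refine ⟨T, fun a b hab => ?_⟩
  by_cases hb : b ∈ (p a).support
  · refine Or.inl ⟨?_, (h.isAcyclic.eq_snd_of_adj_start (hp a) hab hb).symm⟩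
    rintro (rfl : a = r)
    rw [SimpleGraph.Walk.nil_iff_support_eq.mp (SimpleGraph.Walk.isPath_iff_nil.mp (hp a))] at hb
    exact hab.ne (List.mem_singleton.mp hb).symm
  · refine Or.inr ⟨?_, ?_⟩
    · rintro rfl
      exact hb (p a).end_mem_support
    · have : p b = (p a).cons hab.symm := (hp_unique b _ ((hp a).cons hb)).symm
      simp [T, this]

variable [Fintype W] {T : ParentTree W} {Z : Finset V}

lemma HasCopy.exists_card_eq (h : T.HasCopy G Z) :
    ∃ Y, T.HasCopy G Y ∧ Y.card = Fintype.card W := by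
  obtain ⟨φ, hφ⟩ := h
  exact ⟨Finset.univ.image φ, ⟨φ, hφ.inj, hφ.adj, fun w => Finset.mem_image_of_mem φ (by simp)⟩,
    Finset.card_image_of_injective _ hφ.inj⟩

lemma IsEmb.exists_subgraph {T₀ : SimpleGraph W} {φ : W → V} (hφ : T.IsEmb G Z φ)
    (hT : T.IsRootingOf T₀) (hZ : Z.card = Fintype.card W) :
    ∃ H : G.Subgraph, Nonempty (T₀ ≃g H.coe) ∧ H.verts = Z := by
  let f : SimpleGraph.Copy T₀ G := ⟨⟨φ, fun {a b} hab => by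
    rcases hT a b hab with ⟨ha, rfl⟩ | ⟨hb, rfl⟩
    · exact hφ.adj a ha
    · exact (hφ.adj b hb).symm⟩, hφ.inj⟩
  have himage : Finset.univ.image φ = Z := by
    refine Finset.eq_of_subset_of_card_le (Finset.image_subset_iff.mpr fun w _ => hφ.mem w) ?_
    rw [Finset.card_image_of_injective _ hφ.inj, Finset.card_univ, hZ]
  refine ⟨f.toSubgraph, ⟨f.isoToSubgraph⟩, ?_⟩
  rw [← himage]
  ext x
  simp [f, SimpleGraph.Copy.toSubgraph]

variable [Fintype V]

lemma exists_insep_compl_hasCopy [Nonempty V]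
    (hdeg : ∀ v, Fintype.card W + 3 ≤ degIn G Finset.univ v) :
    ∃ K X, 4 ≤ K.card ∧ Insep G 3 K X ∧ T.HasCopy G Xᶜ := by
  obtain ⟨Z, hZ, hZ_card⟩ := (hasCopy_of_le_degIn (T := T) (G := G) Finset.univ_nonempty
    fun v _ => by have := hdeg v; lia).exists_card_eq
  have hdegZ : ∀ v, 3 ≤ degIn G Zᶜ v := by
    intro v
    have := degIn_add_degIn_compl (G := G) Z v
    have := degIn_le_card (G := G) Z v
    have := hdeg v
    lia
  have hne : Zᶜ.Nonempty := by
    obtain ⟨v⟩ := ‹Nonempty V›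
    have := degIn_le_card (G := G) Zᶜ v
    exact Finset.card_pos.mp (by have := hdegZ v; lia)
  obtain ⟨K, hK_card, hK⟩ := exists_insep_of_three_le_degIn hne fun v _ => hdegZ v
  exact ⟨K, Zᶜ, hK_card, hK, by rwa [compl_compl]⟩

theorem exists_insep_self_of_insep_univ [Nonempty V] (hG : Insep G 3 Finset.univ Finset.univ)
    (hdeg : ∀ v, Fintype.card W + 3 ≤ degIn G Finset.univ v) :
    ∃ K, 4 ≤ K.card ∧ Insep G 3 K K ∧ T.HasCopy G Kᶜ ∧ Kᶜ.card = Fintype.card W := by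
  obtain ⟨K, X, D, h⟩ := exists_isExtremal (exists_insep_compl_hasCopy (T := T) hdeg)
  have hX : X = K ∪ D := h.eq_union hG hdeg
  obtain ⟨U, Q, hQ⟩ := h.isMaxInsep.exists_isMinLink (hX ▸ h.insep) (hX ▸ h.hasCopy)
    h.disjoint h.connOn
  exact ⟨K, h.isMaxInsep.four_le, hQ.insep_self hG hdeg⟩

end ParentTree

end

theorem theorem3p2 {W V : Type*} [Fintype W] [Fintype V]
    (m : ℕ) (T₀ : SimpleGraph W) (hT₀ : T₀.IsTree) (hm : Fintype.card W = m)
    (G : SimpleGraph V) [DecidableRel G.Adj]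
    (hG : G.IsKConnected 3) (hδ : m + 3 ≤ G.minDegree) :
    ∃ T : G.Subgraph, Nonempty (T₀ ≃g T.coe) ∧ (G.induce (T.vertsᶜ)).IsKConnected 3 := by
  classical
  have : Nonempty V := (Nat.card_pos_iff.mp (Nat.zero_lt_of_lt hG.1)).1
  have hdeg : ∀ v, Fintype.card W + 3 ≤ degIn G Finset.univ v := fun v => by
    rw [hm, degIn_univ]
    exact hδ.trans (G.minDegree_le_degree v)
  obtain ⟨T, hT⟩ := ParentTree.exists_isRootingOf hT₀
  obtain ⟨K, hK_card, hK, ⟨φ, hφ⟩, hKc⟩ :=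
    T.exists_insep_self_of_insep_univ (insep_univ_of_isKConnected hG) hdeg
  obtain ⟨H, hH, hverts⟩ := hφ.exists_subgraph hT (by convert hKc)
  refine ⟨H, hH, ?_⟩
  have hK_verts : H.vertsᶜ = (K : Set V) := by simp [hverts]
  rw [hK_verts]
  exact hK.isKConnected_induce hK_card
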